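/- Conventions. Let $\mathbb X$ be a quasi-Banach space over $\mathbb F=\mathbb R$ or $\mathbb C$. A basis of $\mathbb X$ is a norm-bounded family $\mathcal X=(x_n)_{n\in\mathcal N}$, $\mathcal N$ countable, with dense linear span, for which there is a norm-bounded family $(x_n^*)_{n\in\mathcal N}$ in $\mathbb X^*$ with $x_n^*(x_k)=\delta_{n,k}$. A basic sequence in $\mathbb X$ is an infinite countable family that is a basis of its closed linear span; it is complemented if there is a bounded linear projection of $\mathbb X$ onto that span. Put $\mathbf 1_A=\sum_{n\in A}x_n$ for finite $A\subseteq\mathcal N$. The basis is democratic if there is $D\ge 1$ with $\|\mathbf 1_A\|\le D\|\mathbf 1_B\|$ for all finite $A,B$ with $|A|\le|B|$, and for $m\ge 1$ \[ \varphi_u[\mathcal X](m)=\sup_{|A|\le m}\|\mathbf 1_A\|,\qquad \varphi_l[\mathcal X](m)=\inf_{|A|\ge m}\|\mathbf 1_A\| . \] Write $\alpha\approx\beta$ if $C^{-1}\alpha_j\le\beta_j\le C\alpha_j$ for all $j$ and some constant $C\in(0,\infty)$. The notions for a basic sequence are those for it as a basis of its closed span. For infinite $\mathcal N$ with a fixed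 enumeration, let $A_m(f)$ be the set of the $m$ indices $n$ with the largest $|x_n^*(f)|$, ties being broken in favour of indices that come earlier in the enumeration. The basis is truncation quasi-greedy if there is a constant $C$ such that, for all $f\in\mathbb X$ and $m\ge 1$, \[ \min_{n\in A_m(f)}|x_n^*(f)|\,\Bigl\|\sum_{n\in A_m(f)}\operatorname{sgn}(x_n^*(f))\,x_n\Bigr\|\le C\|f\|, \] where $\operatorname{sgn}(0)=1$ and $\operatorname{sgn}(a)=a/|a|$ for $a\neq 0$. A sequence space on $\mathcal N$ is a quasi-Banach space $\mathbb S\subseteq\mathbb F^{\mathcal N}$ in which the unit vectors $e_n$ have norm one, and such that $f\in\mathbb S$ and $|g|\le|f|$ imply $g\in\mathbb S$ and $\|g\|\le\|f\|$; it is symmetric if $f\in\mathbb S$ implies $f\circ\pi\in\mathbb S$ and $\|f\circ\pi\|=\|f\|$ for every permutation $\pi$ of $\mathcal N$. The basis $\mathcal X$ is squeeze-symmetric if there are symmetric sequence spaces $\mathbb S_1$, $\mathbb S_2$ on $\mathcal N$ with $\|\sum_{n\in A}e_n\|_{\mathbb S_1}\approx\|\sum_{n\in A}e_n\|_{\mathbb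 S_2}$ for finite $A\subseteq\mathcal N$, and a constant $C$, such that (a) for every $g\in\mathbb S_1$ there is $f\in\mathbb X$ with $x_n^*(f)=g_n$ for all $n$ and $\|f\|\le C\|g\|_{\mathbb S_1}$, where $f=\sum_n g_n x_n$ whenever $g$ has finite support (this last clause is automatic if $0$ is the only vector all of whose coefficients vanish); (b) for every $f\in\mathbb X$ we have $(x_n^*(f))_{n\in\mathcal N}\in\mathbb S_2$ and $\|(x_n^*(f))_n\|_{\mathbb S_2}\le C\|f\|$. Statement. Let $\mathcal X$ be a squeeze-symmetric basis of a quasi-Banach space $\mathbb X$ with \[ \sum_{m=1}^\infty\frac{1}{\varphi_u[\mathcal X](m)}<\infty , \] and let $\mathcal Y$ be a complemented truncation quasi-greedy basic sequence in $\mathbb X$ (in particular, $\mathcal Y$ may be any truncation quasi-greedy basis of $\mathbb X$). Then $\mathcal Y$ is democratic, and \[ \varphi_l[\mathcal X]\approx\varphi_l[\mathcal Y]\approx\varphi_u[\mathcal Y]\approx\varphi_u[\mathcal X]. \] -/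

import Mathlib

open scoped ENNReal NNReal

/-- A quasi-norm on a vector space over `𝕜` (which is `ℝ` or `ℂ`). -/
structure QuasiNorm (𝕜 X : Type*) [RCLike 𝕜] [AddCommGroup X] [Module 𝕜 X] where
  toFun : X → ℝ
  nonneg : ∀ f, 0 ≤ toFun f
  eq_zero_iff : ∀ f, toFun f = 0 ↔ f = 0
  smul : ∀ (c : 𝕜) f, toFun (c • f) = ‖c‖ * toFun f
  exists_concavity : ∃ κ : ℝ, ∀ f g, toFun (f + g) ≤ κ * (toFun f + toFun g)

namespace QuasiNorm

variable {𝕜 X : Type*} [RCLike 𝕜] [AddCommGroup X] [Module 𝕜 X]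

instance : CoeFun (QuasiNorm 𝕜 X) (fun _ => X → ℝ) := ⟨QuasiNorm.toFun⟩

/-- A quasi-normed space is quasi-Banach if every Cauchy sequence converges. -/
def IsComplete (q : QuasiNorm 𝕜 X) : Prop :=
  ∀ u : ℕ → X,
    (∀ ε : ℝ, 0 < ε → ∃ N, ∀ m n, N ≤ m → N ≤ n → q (u m - u n) < ε) →
    ∃ f, ∀ ε : ℝ, 0 < ε → ∃ N, ∀ n, N ≤ n → q (u n - f) < ε

/-- The restriction of a quasi-norm to a linear subspace. -/
def restrict (q : QuasiNorm 𝕜 X) (W : Submodule 𝕜 X) : QuasiNorm 𝕜 W where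
  toFun f := q (f : X)
  nonneg f := q.nonneg _
  eq_zero_iff f := by simp [q.eq_zero_iff]
  smul c f := q.smul c _
  exists_concavity := by
    obtain ⟨κ, h⟩ := q.exists_concavity
    exact ⟨κ, fun f g => h _ _⟩

/-- The closed linear span, in the topology given by the quasi-norm, of a family of vectors. -/
def closedSpan (q : QuasiNorm 𝕜 X) {ι : Type*} (y : ι → X) : Submodule 𝕜 X where
  carrier := {f | ∀ ε : ℝ, 0 < ε → ∃ g ∈ Submodule.span 𝕜 (Set.range y), q (f - g) < ε}
  zero_mem' := fun ε hε => ⟨0, Submodule.zero_mem _, by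
    rw [sub_zero, (q.eq_zero_iff 0).2 rfl]; exact hε⟩
  add_mem' := by
    intro a b ha hb ε hε
    obtain ⟨κ, hκ⟩ := q.exists_concavity
    have hK : 0 < |κ| + 1 := by positivity
    obtain ⟨g, hg, hg'⟩ := ha (ε / (2 * (|κ| + 1))) (by positivity)
    obtain ⟨k, hk, hk'⟩ := hb (ε / (2 * (|κ| + 1))) (by positivity)
    refine ⟨g + k, Submodule.add_mem _ hg hk, ?_⟩
    have h1 := hκ (a - g) (b - k)
    have h2 : a + b - (g + k) = (a - g) + (b - k) := by abel
    rw [h2]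
    have h0 : 0 ≤ q (a - g) + q (b - k) := add_nonneg (q.nonneg _) (q.nonneg _)
    calc q ((a - g) + (b - k)) ≤ κ * (q (a - g) + q (b - k)) := h1
      _ ≤ (|κ| + 1) * (q (a - g) + q (b - k)) := by
          apply mul_le_mul_of_nonneg_right _ h0
          linarith [le_abs_self κ]
      _ < (|κ| + 1) * (ε / (2 * (|κ| + 1)) + ε / (2 * (|κ| + 1))) := by
          apply mul_lt_mul_of_pos_left _ hK
          linarith
      _ = ε := by field_simp; ring
  smul_mem' := by
    intro c a ha ε hε
    have hK : 0 < ‖c‖ + 1 := by positivity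
    obtain ⟨g, hg, hg'⟩ := ha (ε / (‖c‖ + 1)) (by positivity)
    refine ⟨c • g, Submodule.smul_mem _ _ hg, ?_⟩
    rw [← smul_sub]
    calc q (c • (a - g)) = ‖c‖ * q (a - g) := q.smul _ _
      _ ≤ (‖c‖ + 1) * q (a - g) :=
          mul_le_mul_of_nonneg_right (by linarith) (q.nonneg _)
      _ < (‖c‖ + 1) * (ε / (‖c‖ + 1)) := mul_lt_mul_of_pos_left hg' hK
      _ = ε := by field_simp

end QuasiNorm

/-- A basis of a quasi-normed space: a norm-bounded family whose linear span is dense, together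
with its (uniquely determined) norm-bounded biorthogonal family of coordinate functionals. -/
structure QBasis {𝕜 X : Type*} [RCLike 𝕜] [AddCommGroup X] [Module 𝕜 X]
    (q : QuasiNorm 𝕜 X) (ι : Type*) where
  vec : ι → X
  coord : ι → X →ₗ[𝕜] 𝕜
  vec_bounded : ∃ C : ℝ, ∀ n, q (vec n) ≤ C
  coord_bounded : ∃ C : ℝ, ∀ n f, ‖coord n f‖ ≤ C * q f
  coord_vec_self : ∀ n, coord n (vec n) = 1
  coord_vec_of_ne : ∀ n k, n ≠ k → coord n (vec k) = 0
  generates : q.closedSpan vec = ⊤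

/-- A basic sequence: a family of vectors that is a basis of its closed linear span. -/
structure BasicSequence {𝕜 X : Type*} [RCLike 𝕜] [AddCommGroup X] [Module 𝕜 X]
    (q : QuasiNorm 𝕜 X) (ι : Type*) where
  vec : ι → X
  basis : QBasis (q.restrict (q.closedSpan vec)) ι
  coe_basis_vec : ∀ i, (basis.vec i : X) = vec i

/-- A basic sequence is complemented if there is a bounded linear projection of the whole space
onto its closed linear span. -/
def BasicSequence.IsComplemented {𝕜 X : Type*} [RCLike 𝕜] [AddCommGroup X] [Module 𝕜 X]
    {q : QuasiNorm 𝕜 X} {ι : Type*} (𝒴 : BasicSequence q ι) : Prop :=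
  ∃ P : X →ₗ[𝕜] q.closedSpan 𝒴.vec,
    (∃ C : ℝ, ∀ f, q (P f : X) ≤ C * q f) ∧ ∀ g : q.closedSpan 𝒴.vec, P (g : X) = g

/-! ### Truncation quasi-greedy bases -/

/-- The sign function, with value `1` at `0`. -/
noncomputable def sgn {𝕜 : Type*} [RCLike 𝕜] (a : 𝕜) : 𝕜 :=
  open Classical in if a = 0 then 1 else a / ((‖a‖ : ℝ) : 𝕜)

namespace QBasis

variable {𝕜 X : Type*} [RCLike 𝕜] [AddCommGroup X] [Module 𝕜 X] {q : QuasiNorm 𝕜 X} {ι : Type*}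

/-- `A` is the greedy set `A_m(f)` of cardinality `m = |A|`: the coefficients on `A` dominate the
ones off `A`, and ties are broken by the enumeration of the index set. -/
def IsGreedySet [Encodable ι] (𝒳 : QBasis q ι) (f : X) (A : Finset ι) : Prop :=
  ∀ i ∈ A, ∀ j ∉ A, ‖𝒳.coord j f‖ < ‖𝒳.coord i f‖ ∨
    (‖𝒳.coord i f‖ = ‖𝒳.coord j f‖ ∧ Encodable.encode i < Encodable.encode j)

/-- The vector `min_{n ∈ A} |x_n^*(f)| ∑_{n ∈ A} sgn (x_n^*(f)) x_n`, which is the restricted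
truncation `R_m(f)` when `A` is the greedy set `A_m(f)`. -/
noncomputable def truncation (𝒳 : QBasis q ι) (f : X) (A : Finset ι) (hA : A.Nonempty) : X :=
  ((A.inf' hA (fun n => ‖𝒳.coord n f‖) : ℝ) : 𝕜) • ∑ n ∈ A, sgn (𝒳.coord n f) • 𝒳.vec n

/-- Truncation quasi-greedy bases: the operators `R_m`, `m ≥ 1`, are uniformly bounded. -/
def IsTruncationQuasiGreedy [Encodable ι] (𝒳 : QBasis q ι) : Prop :=
  ∃ C : ℝ, ∀ (f : X) (A : Finset ι) (hA : A.Nonempty), 𝒳.IsGreedySet f A →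
    q (𝒳.truncation f A hA) ≤ C * q f

end QBasis

/-! ### Democracy -/

section Democracy

variable {𝕜 X : Type*} [RCLike 𝕜] [AddCommGroup X] [Module 𝕜 X] {ι : Type*}

/-- Democratic families. -/
def IsDemocratic (q : QuasiNorm 𝕜 X) (x : ι → X) : Prop :=
  ∃ D : ℝ, 1 ≤ D ∧ ∀ A B : Finset ι, A.card ≤ B.card →
    q (∑ n ∈ A, x n) ≤ D * q (∑ n ∈ B, x n)

/-- The upper democracy function `φ_u(m) = sup_{|A| ≤ m} ‖∑_{n ∈ A} x_n‖`. -/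
noncomputable def upperDemocracy (q : QuasiNorm 𝕜 X) (x : ι → X) (m : ℕ+) : ℝ≥0∞ :=
  ⨆ (A : Finset ι) (_ : A.card ≤ m), ENNReal.ofReal (q (∑ n ∈ A, x n))

/-- The lower democracy function `φ_l(m) = inf_{|A| ≥ m} ‖∑_{n ∈ A} x_n‖`. -/
noncomputable def lowerDemocracy (q : QuasiNorm 𝕜 X) (x : ι → X) (m : ℕ+) : ℝ≥0∞ :=
  ⨅ (A : Finset ι) (_ : (m : ℕ) ≤ A.card), ENNReal.ofReal (q (∑ n ∈ A, x n))

end Democracy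

/-- `α_j ≲ β_j`: there is a (finite) positive constant `C` with `α_j ≤ C β_j` for all `j`. -/
def Dominated {J : Type*} (α β : J → ℝ≥0∞) : Prop :=
  ∃ C : ℝ≥0, 0 < C ∧ ∀ j, α j ≤ (C : ℝ≥0∞) * β j

/-- `α_j ≈ β_j`: each of the two families is dominated by the other. -/
def Equivalent {J : Type*} (α β : J → ℝ≥0∞) : Prop :=
  Dominated α β ∧ Dominated β α

/-! ### Sequence spaces and squeeze-symmetric bases -/

/-- A sequence space on `ι`: a quasi-Banach space of scalar families, in which the unit vectors
have norm one, and which is solid. -/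
structure SequenceSpace (𝕜 ι : Type*) [RCLike 𝕜] [DecidableEq ι] where
  carrier : Submodule 𝕜 (ι → 𝕜)
  norm : QuasiNorm 𝕜 carrier
  complete : norm.IsComplete
  single_mem : ∀ n, (Pi.single n (1 : 𝕜) : ι → 𝕜) ∈ carrier
  norm_single : ∀ n, norm ⟨Pi.single n 1, single_mem n⟩ = 1
  solid : ∀ (f : carrier) (g : ι → 𝕜), (∀ n, ‖g n‖ ≤ ‖(f : ι → 𝕜) n‖) →
    ∃ hg : g ∈ carrier, norm ⟨g, hg⟩ ≤ norm f

namespace SequenceSpace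

variable {𝕜 ι : Type*} [RCLike 𝕜] [DecidableEq ι]

/-- The unit vector `e_n` as an element of the sequence space. -/
def unitVec (S : SequenceSpace 𝕜 ι) (n : ι) : S.carrier := ⟨Pi.single n 1, S.single_mem n⟩

/-- Symmetric sequence spaces. -/
def IsSymmetric (S : SequenceSpace 𝕜 ι) : Prop :=
  ∀ (f : S.carrier) (π : Equiv.Perm ι),
    ∃ h : (fun n => (f : ι → 𝕜) (π n)) ∈ S.carrier, S.norm ⟨_, h⟩ = S.norm f

variable {X : Type*} [AddCommGroup X] [Module 𝕜 X] {q : QuasiNorm 𝕜 X}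

/-- The sequence space `S` embeds in `X` via the basis `𝒳`: every `g ∈ S` is the coefficient
family of some `f ∈ X` with `‖f‖ ≤ C ‖g‖`, where `f = ∑ g_n x_n` if `g` has finite support.
The last clause is automatic if vectors are determined by their coefficients
(see `embedsVia_of_total`); without it, `f` could be changed by a vector all of whose
coefficients vanish, and nothing would be said on the norms of the sums `∑ g_n x_n`. -/
def EmbedsVia (S : SequenceSpace 𝕜 ι) (𝒳 : QBasis q ι) : Prop :=
  ∃ C : ℝ, ∀ g : S.carrier, ∃ f : X,
    (∀ n, 𝒳.coord n f = (g : ι → 𝕜) n) ∧ q f ≤ C * S.norm g ∧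
    ∀ A : Finset ι, (∀ n ∉ A, (g : ι → 𝕜) n = 0) → f = ∑ n ∈ A, (g : ι → 𝕜) n • 𝒳.vec n

/-- The space `X` embeds in the sequence space `S` via the basis `𝒳`: the coefficient transform
is bounded from `X` into `S`. -/
def ReceivesVia (S : SequenceSpace 𝕜 ι) (𝒳 : QBasis q ι) : Prop :=
  ∃ C : ℝ, ∀ f : X, ∃ h : (fun n => 𝒳.coord n f) ∈ S.carrier, S.norm ⟨_, h⟩ ≤ C * q f

/-- If vectors are determined by their coefficients, the clause on finitely supported families
in `EmbedsVia` is redundant. -/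
theorem embedsVia_of_total (S : SequenceSpace 𝕜 ι) (𝒳 : QBasis q ι)
    (htotal : ∀ f, (∀ n, 𝒳.coord n f = 0) → f = 0)
    (h : ∃ C : ℝ, ∀ g : S.carrier, ∃ f : X,
      (∀ n, 𝒳.coord n f = (g : ι → 𝕜) n) ∧ q f ≤ C * S.norm g) : S.EmbedsVia 𝒳 := by
  obtain ⟨C, hC⟩ := h
  refine ⟨C, fun g => ?_⟩
  obtain ⟨f, hf, hfC⟩ := hC g
  refine ⟨f, hf, hfC, fun A hA => sub_eq_zero.1 (htotal _ fun n => ?_)⟩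
  have key : ∀ k, 𝒳.coord n (𝒳.vec k) = if n = k then 1 else 0 := by
    intro k
    split_ifs with hnk
    · rw [← hnk, 𝒳.coord_vec_self]
    · exact 𝒳.coord_vec_of_ne n k hnk
  by_cases hn : n ∈ A
  · simp [hf, key, hn]
  · simp [hf, key, hn, hA n hn]

end SequenceSpace

/-- Squeeze-symmetric bases: there are symmetric sequence spaces `S₁` and `S₂`, whose norms are
equivalent on indicator functions of finite sets, with `S₁ ↪ X ↪ S₂` via the basis. -/
def QBasis.IsSqueezeSymmetric {𝕜 X : Type*} [RCLike 𝕜] [AddCommGroup X] [Module 𝕜 X]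
    {q : QuasiNorm 𝕜 X} {ι : Type*} [DecidableEq ι] (𝒳 : QBasis q ι) : Prop :=
  ∃ S₁ S₂ : SequenceSpace 𝕜 ι, S₁.IsSymmetric ∧ S₂.IsSymmetric ∧
    Equivalent (fun A : Finset ι => ENNReal.ofReal (S₁.norm (∑ n ∈ A, S₁.unitVec n)))
      (fun A : Finset ι => ENNReal.ofReal (S₂.norm (∑ n ∈ A, S₂.unitVec n))) ∧
    S₁.EmbedsVia 𝒳 ∧ S₂.ReceivesVia 𝒳

/-! Let `Φ` be the upper democracy function of `𝒳`, and let `u i` be the coordinate functionals of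
`𝒴` composed with the projection. Squeeze-symmetry says that sums over `A` with coefficients in the
unit ball have norm at most a constant times `Φ |A|`, and that coefficients of `f` of size at least
`t` on `A` force `t Φ |A| ≲ ‖f‖`. As `1 / Φ` is summable, the latter maps `X` into `ℓ₁`, with tails
uniformly small: every `y j` is, up to a small `ℓ₁` error, carried by a set `F j` of at most `M`
indices. Hence `u i (y j) = ∑ n, 𝒳.coord n (y j) * u i (𝒳.vec n)`.

Lower estimate (`exists_le_norm_sum`). The diagonal identity `u j (y j) = 1` gives an index `n j` at
which both factors are bounded below, and each index serves boundedly many `j`. Averaging over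
subsets `S` of `A`, some `∑ j ∈ S, y j` has large coefficients at half of the indices `n j`, so `Φ
|A| ≲ ‖∑ j ∈ S, y j‖`. Truncation passes from `S` to `A`.

Upper estimate (`exists_norm_sum_le`). By the lower estimate the `u j` also map `X` into `ℓ₁`. So
the matrix `𝒳.coord n (y j)` cut to `F j`, and the error matrix `E` of the cut, have `ℓ₁`-bounded
columns. Beck–Fiala yields signs `ε j` for which all row sums are bounded and `E ε` is at most `1 /
2`. The vector `g` with the cut row sums as coefficients lives on at most `M |A|` indices, so `‖g‖ ≲
Φ |A|`, while `|u i g| ≥ 1 / 2` on `A`. Truncation gives `‖∑ j ∈ A, y j‖ ≲ ‖g‖`. No convexity is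
used: the quasi-norm enters only through these estimates. -/

/-! ### Sums in quasi-normed spaces. -/

namespace QuasiNorm

variable {𝕜 X : Type*} [RCLike 𝕜] [AddCommGroup X] [Module 𝕜 X] (q : QuasiNorm 𝕜 X)

theorem exists_one_le_concavity :
    ∃ κ : ℝ, 1 ≤ κ ∧ ∀ f g, q (f + g) ≤ κ * (q f + q g) := by
  obtain ⟨κ, hκ⟩ := q.exists_concavity
  exact ⟨max κ 1, le_max_right _ _, fun f g => (hκ f g).trans
    (mul_le_mul_of_nonneg_right (le_max_left _ _) (add_nonneg (q.nonneg _) (q.nonneg _)))⟩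

theorem map_zero : q 0 = 0 := (q.eq_zero_iff 0).2 rfl

variable {q}

theorem sum_le {κ : ℝ} (h1 : 1 ≤ κ) (hκ : ∀ f g, q (f + g) ≤ κ * (q f + q g))
    {ι : Type*} (s : Finset ι) (f : ι → X) :
    q (∑ i ∈ s, f i) ≤ κ ^ s.card * ∑ i ∈ s, q (f i) := by
  classical
  induction s using Finset.induction_on with
  | empty => simp [q.map_zero]
  | insert a s ha ih =>
    rw [Finset.sum_insert ha, Finset.sum_insert ha, Finset.card_insert_of_notMem ha, pow_succ']
    have h2 : q (f a) ≤ κ ^ s.card * q (f a) :=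
      le_mul_of_one_le_left (q.nonneg _) (one_le_pow₀ h1)
    calc q (f a + ∑ i ∈ s, f i) ≤ κ * (q (f a) + q (∑ i ∈ s, f i)) := hκ _ _
      _ ≤ κ * (κ ^ s.card * q (f a) + κ ^ s.card * ∑ i ∈ s, q (f i)) := by gcongr
      _ = _ := by ring

/-- The sums `∑ a_i v_i` with coefficients in the unit ball are controlled by the sums of the
subfamilies of `v`. -/
theorem exists_forall_sum_smul_le (q : QuasiNorm 𝕜 X) (ι : Type*) :
    ∃ C : ℝ, 0 < C ∧ ∀ (A : Finset ι) (v : ι → X) (K : ℝ), (∀ B ⊆ A, q (∑ i ∈ B, v i) ≤ K) →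
      ∀ a : ι → 𝕜, (∀ i ∈ A, ‖a i‖ ≤ 1) → q (∑ i ∈ A, a i • v i) ≤ C * K := by
  classical
  obtain ⟨κ, h1, hκ⟩ := q.exists_one_le_concavity
  have hκ0 : 0 < κ := by linarith
  -- Round the coefficients to a net of mesh `1 / (2 * κ)`: the remainder, rescaled by `2 * κ`, is
  -- admissible again, and after the loss of `κ` its contribution is halved at each iteration.
  obtain ⟨Z, hZ1, hZf, hZ⟩ :=
    (isCompact_closedBall (0 : 𝕜) 1).finite_cover_balls (e := 1 / (2 * κ)) (by positivity)
  lift Z to Finset 𝕜 using hZf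
  set D : ℝ := κ ^ Z.card * Z.card with hD
  refine ⟨2 * κ * D + 1, by positivity, fun A v K hK a ha => ?_⟩
  have hK0 : 0 ≤ K := (q.nonneg _).trans (hK ∅ (by simp))
  set R : ℝ := κ ^ A.card * ∑ i ∈ A, q (v i) with hR
  have key : ∀ (k : ℕ) (a : ι → 𝕜), (∀ i ∈ A, ‖a i‖ ≤ 1) →
      q (∑ i ∈ A, a i • v i) ≤ 2 * κ * D * K + (1 / 2) ^ k * R := by
    intro k
    induction k with
    | zero =>
      intro a ha
      have : q (∑ i ∈ A, a i • v i) ≤ R := by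
        refine (sum_le h1 hκ _ _).trans ?_
        rw [hR]
        gcongr with i hi
        rw [q.smul]
        exact mul_le_of_le_one_left (q.nonneg _) (ha i hi)
      have : 0 ≤ 2 * κ * D * K := by positivity
      simp; linarith
    | succ k ih =>
      intro a ha
      have hex : ∀ i ∈ A, ∃ z ∈ Z, ‖a i - z‖ < 1 / (2 * κ) := by
        intro i hi
        have := hZ (show a i ∈ Metric.closedBall 0 1 by simpa using ha i hi)
        simpa [dist_eq_norm] using this
      choose! z hzZ hz using hex
      have hdec : ∑ i ∈ A, a i • v i = ∑ i ∈ A, z i • v i +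
          ((1 / (2 * κ) : ℝ) : 𝕜) • ∑ i ∈ A, (((2 * κ : ℝ) : 𝕜) * (a i - z i)) • v i := by
        rw [Finset.smul_sum, ← Finset.sum_add_distrib]
        refine Finset.sum_congr rfl fun i _ => ?_
        rw [smul_smul, ← mul_assoc, ← RCLike.ofReal_mul, one_div,
          inv_mul_cancel₀ (by positivity), RCLike.ofReal_one, one_mul, ← add_smul]
        simp
      have hfirst : q (∑ i ∈ A, z i • v i) ≤ D * K := by
        rw [← Finset.sum_fiberwise_of_maps_to hzZ]
        refine (sum_le h1 hκ _ _).trans ?_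
        rw [hD, mul_assoc, ← nsmul_eq_mul]
        refine mul_le_mul_of_nonneg_left (Finset.sum_le_card_nsmul _ _ _ fun w hw => ?_)
          (by positivity)
        have : ∑ i ∈ A with z i = w, z i • v i = w • ∑ i ∈ A with z i = w, v i := by
          rw [Finset.smul_sum]
          refine Finset.sum_congr rfl fun i hi => ?_
          rw [(Finset.mem_filter.1 hi).2]
        rw [this, q.smul]
        have hw1 : ‖w‖ ≤ 1 := by simpa using hZ1 hw
        calc ‖w‖ * q _ ≤ 1 * K :=
              mul_le_mul hw1 (hK _ (Finset.filter_subset _ _)) (q.nonneg _) zero_le_one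
          _ = K := one_mul K
      have hsecond := ih (fun i => ((2 * κ : ℝ) : 𝕜) * (a i - z i)) (by
        intro i hi
        rw [norm_mul, RCLike.norm_ofReal, abs_of_pos (by positivity)]
        have := (hz i hi).le
        calc 2 * κ * ‖a i - z i‖ ≤ 2 * κ * (1 / (2 * κ)) := by gcongr
          _ = 1 := by field_simp)
      calc q (∑ i ∈ A, a i • v i) ≤ κ * (D * K + 1 / (2 * κ) *
            (2 * κ * D * K + (1 / 2) ^ k * R)) := by
            rw [hdec]
            refine (hκ _ _).trans ?_
            rw [q.smul, RCLike.norm_ofReal, abs_of_pos (by positivity)]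
            gcongr
        _ = _ := by field_simp; ring
  have hlim : Filter.Tendsto (fun k : ℕ => 2 * κ * D * K + (1 / 2) ^ k * R) Filter.atTop
      (nhds (2 * κ * D * K + 0 * R)) :=
    ((tendsto_pow_atTop_nhds_zero_of_lt_one (by norm_num) (by norm_num)).mul_const R).const_add _
  have := ge_of_tendsto' hlim fun k => key k a ha
  linarith

end QuasiNorm

/-! ### Choice of signs and weak-type tails. -/

/-- Beck–Fiala: if the columns of a real matrix have `ℓ₁`-norm at most `D`, any point of the cube
can be rounded to a vertex, changing each row sum by at most `2 * D`. -/
theorem exists_sign_abs_sum_mul_sub_le {R J : Type*} [Fintype R] {D : ℝ} (hD : 0 < D)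
    (L : R → J → ℝ) (F : Finset J) (hL : ∀ j ∈ F, ∑ r, |L r j| ≤ D) (x : J → ℝ)
    (hx : ∀ j ∈ F, |x j| ≤ 1) :
    ∃ ε : J → ℝ, (∀ j, |ε j| = 1) ∧ ∀ r, |∑ j ∈ F, L r j * (ε j - x j)| ≤ 2 * D := by
  classical
  induction hn : F.card generalizing F x with
  | zero =>
    rw [Finset.card_eq_zero] at hn
    subst hn
    exact ⟨fun _ => 1, by simp, by simp [hD.le]⟩
  | succ k ih =>
    have hFne : F.Nonempty := Finset.card_pos.1 (by omega)
    -- Rows whose mass on the unfrozen columns exceeds `D`. Counting mass in two ways, there are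
    -- fewer of them than unfrozen columns, so they have a common kernel vector.
    let Rd : Finset R := Finset.univ.filter fun r => D < ∑ j ∈ F, |L r j|
    have hcard : Rd.card < F.card := by
      rcases Rd.eq_empty_or_nonempty with h | h
      · rw [h]; simpa using hFne
      · have h1 : Rd.card • D < ∑ r ∈ Rd, ∑ j ∈ F, |L r j| := by
          rw [← Finset.sum_const]
          exact Finset.sum_lt_sum_of_nonempty h fun r hr => (Finset.mem_filter.1 hr).2
        have h2 : ∑ r ∈ Rd, ∑ j ∈ F, |L r j| ≤ F.card • D := by
          rw [Finset.sum_comm, ← Finset.sum_const]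
          refine Finset.sum_le_sum fun j hj => le_trans ?_ (hL j hj)
          exact Finset.sum_le_sum_of_subset_of_nonneg (Finset.subset_univ _)
            fun _ _ _ => abs_nonneg _
        have h3 := h1.trans_le h2
        rw [nsmul_eq_mul, nsmul_eq_mul] at h3
        exact_mod_cast lt_of_mul_lt_mul_right h3 hD.le
    -- a direction along which the dangerous rows do not change
    obtain ⟨v, hv0, hv⟩ : ∃ v : F → ℝ, v ≠ 0 ∧ ∀ r ∈ Rd, ∑ j : F, L r j * v j = 0 := by
      let T : (F → ℝ) →ₗ[ℝ] (Rd → ℝ) := Matrix.mulVecLin (Matrix.of fun r j => L r j)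
      have hT : LinearMap.ker T ≠ ⊥ := LinearMap.ker_ne_bot_of_finrank_lt (by simpa using hcard)
      obtain ⟨v, hv, hv0⟩ := Submodule.exists_mem_ne_zero_of_ne_bot hT
      refine ⟨v, hv0, fun r hr => ?_⟩
      have := congrFun (LinearMap.mem_ker.1 hv) ⟨r, hr⟩
      simpa [T, Matrix.mulVec, dotProduct] using this
    -- move until the boundary of the cube is hit
    obtain ⟨t, ht, j₀, hj₀⟩ : ∃ t : ℝ, (∀ j : F, |x j + t * v j| ≤ 1) ∧
        ∃ j : F, |x j + t * v j| = 1 := by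
      let g : ℝ → ℝ := fun t => ‖(fun j : F => x j) + t • v‖
      have hg : Continuous g := by fun_prop
      have hvn : 0 < ‖v‖ := norm_pos_iff.2 hv0
      have hx1 : ‖(fun j : F => x j)‖ ≤ 1 :=
        (pi_norm_le_iff_of_nonneg zero_le_one).2 fun j => hx j j.2
      have hg0 : g 0 ≤ 1 := by simpa [g] using hx1
      have hg1 : 1 ≤ g (2 / ‖v‖) := by
        have h1 : ‖(2 / ‖v‖) • v‖ = 2 := by
          rw [norm_smul, Real.norm_of_nonneg (by positivity)]
          field_simp
        have h2 := norm_sub_le ((fun j : F => x j) + (2 / ‖v‖) • v) (fun j : F => x j)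
        rw [add_sub_cancel_left, h1] at h2
        change 1 ≤ ‖_‖
        linarith
      obtain ⟨t, -, ht⟩ := intermediate_value_Icc (by positivity) hg.continuousOn ⟨hg0, hg1⟩
      have ht' : ∀ j : F, |x j + t * v j| ≤ 1 := fun j =>
        (norm_le_pi_norm ((fun j : F => x j) + t • v) j).trans ht.le
      refine ⟨t, ht', ?_⟩
      by_contra! hne
      exact ht.not_lt ((pi_norm_lt_iff one_pos).2 fun j => lt_of_le_of_ne (ht' j) (hne j))
    let x' : J → ℝ := fun j => if hj : j ∈ F then x j + t * v ⟨j, hj⟩ else 0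
    have hx' : ∀ j (hj : j ∈ F), x' j = x j + t * v ⟨j, hj⟩ := fun j hj => dif_pos hj
    obtain ⟨ε, hε, hεr⟩ := ih (F.erase j₀) (fun j hj => hL j (Finset.mem_of_mem_erase hj)) x'
      (fun j hj => by
        rw [hx' j (Finset.mem_of_mem_erase hj)]; exact ht ⟨j, _⟩)
      (by rw [Finset.card_erase_of_mem j₀.2]; omega)
    have hε' : ∀ j, |Function.update ε j₀ (x' j₀) j| = 1 := by
      intro j
      by_cases h : j = j₀
      · subst h; rw [Function.update_self, hx' _ j₀.2]; exact hj₀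
      · rw [Function.update_of_ne h]; exact hε j
    refine ⟨Function.update ε j₀ (x' j₀), hε', fun r => ?_⟩
    -- A heavy row did not change in this move, so the induction hypothesis applies. A light row has
    -- mass at most `D` left, and each coordinate moves by at most `2` whatever happens.
    by_cases hr : r ∈ Rd
    · have h1 : ∑ j ∈ F, L r j * (x' j - x j) = 0 := by
        rw [← Finset.sum_coe_sort]
        have : ∀ j : F, L r j * (x' j - x j) = t * (L r j * v j) := by
          intro j; rw [hx' j j.2]; ring
        simp only [this]
        rw [← Finset.mul_sum, hv r hr, mul_zero]
      have h2 : ∑ j ∈ F, L r j * (Function.update ε j₀ (x' j₀) j - x j) =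
          ∑ j ∈ F.erase j₀, L r j * (ε j - x' j) := by
        rw [← sub_zero (∑ j ∈ F, _), ← h1, ← Finset.sum_sub_distrib,
          ← Finset.add_sum_erase _ _ j₀.2, Function.update_self]
        simp only [sub_self, zero_add]
        refine Finset.sum_congr rfl fun j hj => ?_
        rw [Function.update_of_ne (Finset.ne_of_mem_erase hj)]; ring
      rw [h2]; exact hεr r
    · have hr' : ∑ j ∈ F, |L r j| ≤ D := by simpa [Rd] using hr
      calc |∑ j ∈ F, L r j * (Function.update ε j₀ (x' j₀) j - x j)|
          ≤ ∑ j ∈ F, |L r j| * 2 := by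
            refine (Finset.abs_sum_le_sum_abs _ _).trans (Finset.sum_le_sum fun j hj => ?_)
            rw [abs_mul]
            gcongr
            exact (abs_sub _ _).trans (by linarith [hx j hj, hε' j])
        _ ≤ 2 * D := by rw [← Finset.sum_mul]; linarith

theorem RCLike.norm_le_abs_re_add_abs_im {𝕜 : Type*} [RCLike 𝕜] (z : 𝕜) :
    ‖z‖ ≤ |RCLike.re z| + |RCLike.im z| := by
  conv_lhs => rw [← RCLike.re_add_im z]
  refine (norm_add_le _ _).trans (add_le_add (RCLike.norm_ofReal _).le ?_)
  rw [norm_mul, RCLike.norm_ofReal]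
  refine mul_le_of_le_one_right (abs_nonneg _) ?_
  rw [RCLike.norm_I]
  split_ifs <;> norm_num

/-- Signs making all row sums of a matrix with `ℓ₁`-bounded columns uniformly small. -/
theorem exists_sign_norm_sum_mul_le {𝕜 R J : Type*} [RCLike 𝕜] [Fintype R] {D : ℝ} (hD : 0 < D)
    (L : R → J → 𝕜) (F : Finset J) (hL : ∀ j ∈ F, ∑ r, ‖L r j‖ ≤ D) :
    ∃ ε : J → ℝ, (∀ j, |ε j| = 1) ∧ ∀ r, ‖∑ j ∈ F, (ε j : 𝕜) * L r j‖ ≤ 8 * D := by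
  -- Real and imaginary parts become separate rows, so columns have mass `2 * D`; starting at the
  -- centre of the cube, each part is at most `4 * D`.
  obtain ⟨ε, hε, h⟩ := exists_sign_abs_sum_mul_sub_le (D := 2 * D) (by positivity)
    (fun (r : R ⊕ R) j => Sum.elim (fun r => RCLike.re (L r j)) (fun r => RCLike.im (L r j)) r) F
    (fun j hj => by
      simp only [Fintype.sum_sum_type, Sum.elim_inl, Sum.elim_inr]
      have h1 : ∑ r, |RCLike.re (L r j)| ≤ ∑ r, ‖L r j‖ :=
        Finset.sum_le_sum fun r _ => RCLike.abs_re_le_norm _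
      have h2 : ∑ r, |RCLike.im (L r j)| ≤ ∑ r, ‖L r j‖ :=
        Finset.sum_le_sum fun r _ => RCLike.abs_im_le_norm _
      linarith [hL j hj]) (fun _ => 0) (by simp)
  refine ⟨ε, hε, fun r => ?_⟩
  have h1 := h (Sum.inl r)
  have h2 := h (Sum.inr r)
  simp only [Sum.elim_inl, Sum.elim_inr, sub_zero] at h1 h2
  refine (RCLike.norm_le_abs_re_add_abs_im _).trans ?_
  have e1 : RCLike.re (∑ j ∈ F, (ε j : 𝕜) * L r j) = ∑ j ∈ F, RCLike.re (L r j) * ε j := by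
    rw [map_sum]; exact Finset.sum_congr rfl fun j _ => by rw [RCLike.re_ofReal_mul, mul_comm]
  have e2 : RCLike.im (∑ j ∈ F, (ε j : 𝕜) * L r j) = ∑ j ∈ F, RCLike.im (L r j) * ε j := by
    rw [map_sum]; exact Finset.sum_congr rfl fun j _ => by rw [RCLike.im_ofReal_mul, mul_comm]
  rw [e1, e2]; linarith

/-- A family in the weak space with weight `Φ` has tail sums controlled by those of `1 / Φ`. -/
theorem exists_subset_sum_sdiff_le {ι : Type*} [DecidableEq ι] {Φ : ℕ → ℝ}
    (hΦ : ∀ m, m ≠ 0 → 0 < Φ m) {a : ι → ℝ} {K : ℝ}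
    (ha : ∀ (A : Finset ι) (t : ℝ), (∀ n ∈ A, t ≤ a n) → t * Φ A.card ≤ K)
    (M : ℕ) (B : Finset ι) :
    ∃ F ⊆ B, F.card ≤ M ∧ ∑ n ∈ B \ F, a n ≤ K * ∑ m ∈ Finset.Ioc M B.card, (Φ m)⁻¹ := by
  induction hn : B.card generalizing B with
  | zero => exact ⟨∅, by simp, by simp, by rw [Finset.card_eq_zero] at hn; simp [hn]⟩
  | succ k ih =>
    by_cases hM : k + 1 ≤ M
    · exact ⟨B, subset_rfl, hn ▸ hM, by simp [hM]⟩
    -- The least of `k + 1` values is at most `K / Φ (k + 1)`; peel it off and continue until `M`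
    -- indices remain.
    · obtain ⟨b, hb, hmin⟩ := B.exists_min_image a (Finset.card_pos.1 (by omega))
      obtain ⟨F, hF, hFM, hs⟩ := ih (B.erase b) (by rw [Finset.card_erase_of_mem hb]; omega)
      refine ⟨F, hF.trans (Finset.erase_subset _ _), hFM, ?_⟩
      have hbF : b ∉ F := fun h => by simpa using hF h
      have e1 : B \ F = insert b (B.erase b \ F) := by
        rw [← Finset.insert_sdiff_of_notMem _ hbF, Finset.insert_erase hb]
      have e2 : Finset.Ioc M (k + 1) = insert (k + 1) (Finset.Ioc M k) := by
        ext m; simp; omega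
      rw [e1, Finset.sum_insert (by simp), e2, Finset.sum_insert (by simp), mul_add]
      refine add_le_add ?_ hs
      have := ha B (a b) hmin
      rw [hn] at this
      rwa [← div_eq_mul_inv, le_div_iff₀ (hΦ _ (by omega))]

/-! ### Symmetric sequence spaces -/

theorem Dominated.exists_forall_le {J : Type*} {a b : J → ℝ} (hb : ∀ j, 0 ≤ b j)
    (h : Dominated (fun j => ENNReal.ofReal (a j)) (fun j => ENNReal.ofReal (b j))) :
    ∃ C : ℝ, 0 < C ∧ ∀ j, a j ≤ C * b j := by
  obtain ⟨C, hC, h⟩ := h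
  refine ⟨C, hC, fun j => ?_⟩
  have : ENNReal.ofReal (a j) ≤ C * ENNReal.ofReal (b j) := h j
  rwa [← ENNReal.ofReal_coe_nnreal, ← ENNReal.ofReal_mul C.coe_nonneg,
    ENNReal.ofReal_le_ofReal_iff (mul_nonneg C.coe_nonneg (hb j))] at this

open scoped Pointwise in
theorem exists_perm_forall_mem_iff {ι : Type*} [DecidableEq ι] {A B : Finset ι}
    (h : A.card = B.card) : ∃ π : Equiv.Perm ι, ∀ n, π n ∈ B ↔ n ∈ A := by
  have := Set.powersetCard.isPretransitive (α := ι) (n := B.card)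
  obtain ⟨π, hπ⟩ := MulAction.exists_smul_eq (Equiv.Perm ι)
    (⟨A, h⟩ : Set.powersetCard ι B.card) ⟨B, rfl⟩
  have hπ' : π • A = B := congrArg Subtype.val hπ
  refine ⟨π, fun n => ?_⟩
  rw [← hπ']
  exact Finset.smul_mem_smul_finset_iff π

namespace SequenceSpace

variable {𝕜 ι : Type*} [RCLike 𝕜] [DecidableEq ι] (S : SequenceSpace 𝕜 ι)

theorem coe_sum_unitVec_apply (A : Finset ι) (n : ι) :
    ((∑ k ∈ A, S.unitVec k : S.carrier) : ι → 𝕜) n = if n ∈ A then 1 else 0 := by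
  rw [Submodule.coe_sum, Finset.sum_apply]
  simp [unitVec, Pi.single_apply]

variable {S}

theorem norm_le_of_forall_le {f g : S.carrier}
    (h : ∀ n, ‖(g : ι → 𝕜) n‖ ≤ ‖(f : ι → 𝕜) n‖) : S.norm g ≤ S.norm f :=
  (S.solid f g h).2

theorem mul_norm_sum_unitVec_le (f : S.carrier) (A : Finset ι) {t : ℝ} (ht : 0 ≤ t)
    (h : ∀ n ∈ A, t ≤ ‖(f : ι → 𝕜) n‖) : t * S.norm (∑ n ∈ A, S.unitVec n) ≤ S.norm f := by
  have h1 := S.norm.smul (t : 𝕜) (∑ n ∈ A, S.unitVec n)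
  rw [RCLike.norm_ofReal, abs_of_nonneg ht] at h1
  rw [← h1]
  refine norm_le_of_forall_le fun n => ?_
  rw [Submodule.coe_smul, Pi.smul_apply, coe_sum_unitVec_apply]
  split_ifs with hn
  · simpa [abs_of_nonneg ht] using h n hn
  · simp

/-- A permutation carries `A` into `B`; solidity does the rest. -/
theorem IsSymmetric.norm_sum_unitVec_le (hS : S.IsSymmetric) {A B : Finset ι}
    (h : A.card ≤ B.card) :
    S.norm (∑ n ∈ A, S.unitVec n) ≤ S.norm (∑ n ∈ B, S.unitVec n) := by
  obtain ⟨B', hB', hc⟩ := Finset.exists_subset_card_eq h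
  obtain ⟨π, hπ⟩ := exists_perm_forall_mem_iff hc.symm
  obtain ⟨hmem, hnorm⟩ := hS (∑ n ∈ B, S.unitVec n) π
  rw [← hnorm]
  refine norm_le_of_forall_le fun n => ?_
  simp only [coe_sum_unitVec_apply]
  by_cases hn : n ∈ A
  · simp [hn, hB' ((hπ n).2 hn)]
  · simp [hn]

end SequenceSpace

/-! ### Squeeze-symmetric bases -/

namespace QBasis

variable {𝕜 X : Type*} [RCLike 𝕜] [AddCommGroup X] [Module 𝕜 X] {q : QuasiNorm 𝕜 X} {ι : Type*}

theorem coord_vec [DecidableEq ι] (𝒳 : QBasis q ι) (n k : ι) :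
    𝒳.coord n (𝒳.vec k) = if n = k then 1 else 0 := by
  split_ifs with h
  · rw [h, 𝒳.coord_vec_self]
  · exact 𝒳.coord_vec_of_ne n k h

theorem coord_sum_smul_vec [DecidableEq ι] (𝒳 : QBasis q ι) (A : Finset ι) (a : ι → 𝕜) (n : ι) :
    𝒳.coord n (∑ k ∈ A, a k • 𝒳.vec k) = if n ∈ A then a n else 0 := by
  simp [coord_vec]

theorem exists_coord_bound (𝒳 : QBasis q ι) :
    ∃ C : ℝ, 0 < C ∧ ∀ n f, ‖𝒳.coord n f‖ ≤ C * q f := by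
  obtain ⟨C, hC⟩ := 𝒳.coord_bounded
  exact ⟨max C 1, by positivity, fun n f => (hC n f).trans
    (mul_le_mul_of_nonneg_right (le_max_left _ _) (q.nonneg _))⟩

theorem exists_vec_bound (𝒳 : QBasis q ι) : ∃ C : ℝ, 0 < C ∧ ∀ n, q (𝒳.vec n) ≤ C := by
  obtain ⟨C, hC⟩ := 𝒳.vec_bounded
  exact ⟨max C 1, by positivity, fun n => (hC n).trans (le_max_left _ _)⟩

/-- Vectors are approximated by finite linear combinations of the basis. -/
theorem exists_approx (𝒳 : QBasis q ι) (f : X) {ε : ℝ} (hε : 0 < ε) :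
    ∃ (A : Finset ι) (a : ι → 𝕜), q (f - ∑ n ∈ A, a n • 𝒳.vec n) < ε := by
  have hf : f ∈ q.closedSpan 𝒳.vec := by rw [𝒳.generates]; trivial
  obtain ⟨g, hg, hfg⟩ := hf ε hε
  obtain ⟨c, rfl⟩ := (Finsupp.mem_span_range_iff_exists_finsupp).1 hg
  exact ⟨c.support, c, hfg⟩

/-- The upper and lower estimates for the norms of a squeeze-symmetric basis. -/
theorem IsSqueezeSymmetric.exists_bounds [DecidableEq ι] {𝒳 : QBasis q ι}
    (h : 𝒳.IsSqueezeSymmetric) :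
    (∃ C : ℝ, 0 < C ∧ ∀ (A : Finset ι) (a : ι → 𝕜), (∀ n ∈ A, ‖a n‖ ≤ 1) →
      q (∑ n ∈ A, a n • 𝒳.vec n) ≤ C * q (∑ n ∈ A, 𝒳.vec n)) ∧
    ∃ C : ℝ, 0 < C ∧ ∀ (f : X) (A B : Finset ι) (t : ℝ), 0 ≤ t →
      (∀ n ∈ A, t ≤ ‖𝒳.coord n f‖) → B.card ≤ A.card → t * q (∑ n ∈ B, 𝒳.vec n) ≤ C * q f := by
  obtain ⟨S₁, S₂, hS₁, -, heq, ⟨C₁, h₁⟩, C₂, h₂⟩ := h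
  obtain ⟨C₃, hC₃, h₃⟩ := heq.1.exists_forall_le fun A => S₂.norm.nonneg _
  have emb : ∀ (A : Finset ι) (a : ι → 𝕜), (∀ n ∈ A, ‖a n‖ ≤ 1) →
      q (∑ n ∈ A, a n • 𝒳.vec n) ≤ max C₁ 1 * S₁.norm (∑ n ∈ A, S₁.unitVec n) := by
    intro A a ha
    obtain ⟨hg, hgn⟩ := S₁.solid (∑ n ∈ A, S₁.unitVec n) (fun n => if n ∈ A then a n else 0)
      (fun n => by
        rw [SequenceSpace.coe_sum_unitVec_apply]
        by_cases hn : n ∈ A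
        · simpa [hn] using ha n hn
        · simp [hn])
    -- The finite-support clause identifies `f` with the sum itself, rather than with some vector
    -- having the same coefficients.
    obtain ⟨f, -, hf, hfs⟩ := h₁ ⟨_, hg⟩
    have := hfs A (fun n hn => by simp [hn])
    have h4 : ∑ n ∈ A, a n • 𝒳.vec n = f := by
      rw [this]
      exact Finset.sum_congr rfl fun n hn => by simp [hn]
    rw [h4]
    calc q f ≤ C₁ * S₁.norm ⟨_, hg⟩ := hf
      _ ≤ max C₁ 1 * S₁.norm ⟨_, hg⟩ :=
          mul_le_mul_of_nonneg_right (le_max_left _ _) (S₁.norm.nonneg _)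
      _ ≤ _ := mul_le_mul_of_nonneg_left hgn (by positivity)
  have hrec : ∀ (f : X) (A : Finset ι) (t : ℝ), 0 ≤ t → (∀ n ∈ A, t ≤ ‖𝒳.coord n f‖) →
      t * S₂.norm (∑ n ∈ A, S₂.unitVec n) ≤ max C₂ 1 * q f := by
    intro f A t ht hA
    obtain ⟨hm, hn⟩ := h₂ f
    exact (SequenceSpace.mul_norm_sum_unitVec_le ⟨_, hm⟩ A ht hA).trans (hn.trans
      (mul_le_mul_of_nonneg_right (le_max_left _ _) (q.nonneg _)))
  have low : ∀ (f : X) (A B : Finset ι) (t : ℝ), 0 ≤ t → (∀ n ∈ A, t ≤ ‖𝒳.coord n f‖) →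
      B.card ≤ A.card → t * S₁.norm (∑ n ∈ B, S₁.unitVec n) ≤ C₃ * (max C₂ 1 * q f) := by
    intro f A B t ht hA hBA
    calc t * S₁.norm (∑ n ∈ B, S₁.unitVec n) ≤ t * S₁.norm (∑ n ∈ A, S₁.unitVec n) :=
          mul_le_mul_of_nonneg_left (hS₁.norm_sum_unitVec_le hBA) ht
      _ ≤ t * (C₃ * S₂.norm (∑ n ∈ A, S₂.unitVec n)) := mul_le_mul_of_nonneg_left (h₃ A) ht
      _ = C₃ * (t * S₂.norm (∑ n ∈ A, S₂.unitVec n)) := by ring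
      _ ≤ _ := mul_le_mul_of_nonneg_left (hrec f A t ht hA) hC₃.le
  refine ⟨⟨max C₁ 1 * (C₃ * max C₂ 1), by positivity, fun A a ha => ?_⟩,
    max C₁ 1 * (C₃ * max C₂ 1), by positivity, fun f A B t ht hA hBA => ?_⟩
  · have := low (∑ n ∈ A, 𝒳.vec n) A A 1 zero_le_one (fun n hn => by
      have := 𝒳.coord_sum_smul_vec A (fun _ => 1) n
      simp only [one_smul] at this
      simp [this, hn]) le_rfl
    rw [one_mul] at this
    calc _ ≤ _ := emb A a ha
      _ ≤ max C₁ 1 * (C₃ * (max C₂ 1 * q (∑ n ∈ A, 𝒳.vec n))) := by gcongr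
      _ = _ := by ring
  · have := emb B (fun _ => 1) (by simp)
    simp only [one_smul] at this
    calc t * q (∑ n ∈ B, 𝒳.vec n) ≤ t * _ := mul_le_mul_of_nonneg_left this ht
      _ = max C₁ 1 * (t * S₁.norm (∑ n ∈ B, S₁.unitVec n)) := by ring
      _ ≤ max C₁ 1 * (C₃ * (max C₂ 1 * q f)) :=
        mul_le_mul_of_nonneg_left (low f A B t ht hA hBA) (by positivity)
      _ = _ := by ring

end QBasis

/-! ### Democracy functions. -/

/-- The upper democracy function with values in `ℝ`, at an arbitrary natural number. -/
noncomputable def realUpperDemocracy {𝕜 X : Type*} [RCLike 𝕜] [AddCommGroup X] [Module 𝕜 X]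
    {ι : Type*} (q : QuasiNorm 𝕜 X) (x : ι → X) (m : ℕ) : ℝ :=
  (⨆ (A : Finset ι) (_ : A.card ≤ m), ENNReal.ofReal (q (∑ n ∈ A, x n))).toReal

section RealUpperDemocracy

variable {𝕜 X : Type*} [RCLike 𝕜] [AddCommGroup X] [Module 𝕜 X] {q : QuasiNorm 𝕜 X} {ι : Type*}
  {x : ι → X}

theorem iSup_ofReal_norm_sum_lt_top (hx : ∃ C : ℝ, ∀ n, q (x n) ≤ C) (m : ℕ) :
    (⨆ (A : Finset ι) (_ : A.card ≤ m), ENNReal.ofReal (q (∑ n ∈ A, x n))) < ∞ := by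
  obtain ⟨C, hC⟩ := hx
  obtain ⟨κ, h1, hκ⟩ := q.exists_one_le_concavity
  refine lt_of_le_of_lt (iSup₂_le fun A hA => ENNReal.ofReal_le_ofReal ?_)
    (ENNReal.ofReal_lt_top (r := κ ^ m * (m * max C 0)))
  refine (QuasiNorm.sum_le h1 hκ A x).trans ?_
  have h2 : ∑ i ∈ A, q (x i) ≤ A.card * max C 0 := by
    rw [← nsmul_eq_mul]
    exact Finset.sum_le_card_nsmul _ _ _ fun i _ => (hC i).trans (le_max_left _ _)
  have h3 : (A.card : ℝ) ≤ m := by exact_mod_cast hA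
  calc κ ^ A.card * ∑ i ∈ A, q (x i) ≤ κ ^ m * (A.card * max C 0) :=
        mul_le_mul (pow_le_pow_right₀ h1 hA) h2
          (Finset.sum_nonneg fun i _ => q.nonneg _) (by positivity)
    _ ≤ _ := by gcongr

theorem norm_sum_le_realUpperDemocracy (hx : ∃ C : ℝ, ∀ n, q (x n) ≤ C) {A : Finset ι} {m : ℕ}
    (hA : A.card ≤ m) : q (∑ n ∈ A, x n) ≤ realUpperDemocracy q x m :=
  (ENNReal.ofReal_le_iff_le_toReal (iSup_ofReal_norm_sum_lt_top hx m).ne).1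
    (le_iSup₂_of_le A hA le_rfl)

theorem realUpperDemocracy_le {K : ℝ} (hK : 0 ≤ K) {m : ℕ}
    (h : ∀ A : Finset ι, A.card ≤ m → q (∑ n ∈ A, x n) ≤ K) : realUpperDemocracy q x m ≤ K :=
  ENNReal.toReal_le_of_le_ofReal hK (iSup₂_le fun A hA => ENNReal.ofReal_le_ofReal (h A hA))

theorem realUpperDemocracy_nonneg (m : ℕ) : 0 ≤ realUpperDemocracy q x m := ENNReal.toReal_nonneg

theorem realUpperDemocracy_mono (hx : ∃ C : ℝ, ∀ n, q (x n) ≤ C) :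
    Monotone (realUpperDemocracy q x) := fun _ _ hkm =>
  realUpperDemocracy_le (realUpperDemocracy_nonneg _) fun _ hA =>
    norm_sum_le_realUpperDemocracy hx (hA.trans hkm)

/-- A set of size `k * m` splits into `k` pieces of size at most `m`. This absorbs bounded factors
in cardinalities. -/
theorem realUpperDemocracy_mul_le (hx : ∃ C : ℝ, ∀ n, q (x n) ≤ C) (k : ℕ) :
    ∃ C : ℝ, 0 < C ∧ ∀ m, realUpperDemocracy q x (k * m) ≤ C * realUpperDemocracy q x m := by
  obtain ⟨κ, h1, hκ⟩ := q.exists_one_le_concavity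
  have hadd : ∀ m n, realUpperDemocracy q x (m + n) ≤
      κ * (realUpperDemocracy q x m + realUpperDemocracy q x n) := by
    classical
    intro m n
    refine realUpperDemocracy_le (mul_nonneg (by linarith) (add_nonneg
      (realUpperDemocracy_nonneg _) (realUpperDemocracy_nonneg _))) fun A hA => ?_
    obtain ⟨B, hB, hBc⟩ := Finset.exists_subset_card_eq (min_le_right m A.card)
    rw [← Finset.sum_sdiff hB, add_comm]
    refine (hκ _ _).trans (mul_le_mul_of_nonneg_left (add_le_add
      (norm_sum_le_realUpperDemocracy hx (by omega))
      (norm_sum_le_realUpperDemocracy hx ?_)) (by linarith))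
    have := Finset.card_sdiff_of_subset hB
    omega
  induction k with
  | zero =>
    refine ⟨1, one_pos, fun m => ?_⟩
    rw [one_mul, zero_mul]
    exact realUpperDemocracy_mono hx (Nat.zero_le m)
  | succ k ih =>
    obtain ⟨C, hC, h⟩ := ih
    refine ⟨κ * (C + 1), by positivity, fun m => ?_⟩
    rw [add_mul, one_mul]
    calc _ ≤ _ := hadd _ _
      _ ≤ κ * (C * realUpperDemocracy q x m + realUpperDemocracy q x m) := by
        gcongr; exact h m
      _ = _ := by ring

/-- A convergent sum has finite terms, so the function cannot vanish at any `m ≠ 0`; the term at `0`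
does not affect summability. -/
theorem realUpperDemocracy_pos_and_summable (hx : ∃ C : ℝ, ∀ n, q (x n) ≤ C)
    (hsum : ∑' m : ℕ+, (upperDemocracy q x m)⁻¹ < ∞) :
    (∀ m, m ≠ 0 → 0 < realUpperDemocracy q x m) ∧
      Summable fun m => (realUpperDemocracy q x m)⁻¹ := by
  constructor
  · intro m hm
    have h1 := ENNReal.ne_top_of_tsum_ne_top hsum.ne ⟨m, Nat.pos_of_ne_zero hm⟩
    exact ENNReal.toReal_pos (ENNReal.inv_ne_top.1 h1) (iSup_ofReal_norm_sum_lt_top hx m).ne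
  · rw [← summable_pnat_iff_summable_nat]
    refine (ENNReal.summable_toReal hsum.ne).congr fun m => ?_
    rw [ENNReal.toReal_inv]
    rfl

/-- If the sums over finite sets have norms equivalent to a function of the cardinality, then the
democracy functions are both equivalent to it. -/
theorem equivalent_lowerDemocracy_upperDemocracy [Infinite ι] {Φ : ℕ → ℝ} (hΦ : Monotone Φ)
    {C C' : ℝ} (hC : 0 < C) (hC' : 0 < C') (hU : ∀ A : Finset ι, q (∑ n ∈ A, x n) ≤ C * Φ A.card)
    (hL : ∀ A : Finset ι, Φ A.card ≤ C' * q (∑ n ∈ A, x n)) :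
    Equivalent (lowerDemocracy q x) (fun m : ℕ+ => ENNReal.ofReal (Φ m)) ∧
      Equivalent (upperDemocracy q x) (fun m : ℕ+ => ENNReal.ofReal (Φ m)) := by
  have hU' : ∀ A : Finset ι, ENNReal.ofReal (q (∑ n ∈ A, x n)) ≤
      C.toNNReal * ENNReal.ofReal (Φ A.card) := fun A => by
    refine (ENNReal.ofReal_le_ofReal (hU A)).trans ?_
    rw [ENNReal.ofReal_mul hC.le]; rfl
  have hL' : ∀ A : Finset ι, ENNReal.ofReal (Φ A.card) ≤
      C'.toNNReal * ENNReal.ofReal (q (∑ n ∈ A, x n)) := fun A => by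
    refine (ENNReal.ofReal_le_ofReal (hL A)).trans ?_
    rw [ENNReal.ofReal_mul hC'.le]; rfl
  have hp := Real.toNNReal_pos.2 hC
  have hp' := Real.toNNReal_pos.2 hC'
  refine ⟨⟨⟨_, hp, fun m => ?_⟩, ⟨_, hp', fun m => ?_⟩⟩, ⟨_, hp, fun m => ?_⟩, ⟨_, hp', fun m => ?_⟩⟩
  · obtain ⟨A, hA⟩ := Infinite.exists_subset_card_eq ι m
    beta_reduce
    rw [← hA]
    exact (iInf₂_le A hA.ge).trans (hU' A)
  · rw [lowerDemocracy, ENNReal.mul_iInf_of_ne (by simpa using hC') ENNReal.coe_ne_top]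
    refine le_iInf fun A => ?_
    rw [ENNReal.mul_iInf_of_ne (by simpa using hC') ENNReal.coe_ne_top]
    exact le_iInf fun hA => (ENNReal.ofReal_le_ofReal (hΦ hA)).trans (hL' A)
  · exact iSup₂_le fun A hA => (hU' A).trans (by beta_reduce; gcongr; exact hΦ hA)
  · obtain ⟨A, hA⟩ := Infinite.exists_subset_card_eq ι m
    beta_reduce
    rw [← hA]
    refine (hL' A).trans (mul_le_mul_right ?_ _)
    exact le_iSup₂_of_le (f := fun (A : Finset ι) (_ : A.card ≤ m) =>
      ENNReal.ofReal (q (∑ n ∈ A, x n))) A hA.le le_rfl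

end RealUpperDemocracy

theorem Equivalent.symm {J : Type*} {α β : J → ℝ≥0∞} (h : Equivalent α β) : Equivalent β α :=
  ⟨h.2, h.1⟩

theorem Dominated.trans {J : Type*} {α β γ : J → ℝ≥0∞} (h : Dominated α β) (h' : Dominated β γ) :
    Dominated α γ := by
  obtain ⟨C, hC, h⟩ := h
  obtain ⟨C', hC', h'⟩ := h'
  refine ⟨C * C', by positivity, fun j => (h j).trans ?_⟩
  rw [ENNReal.coe_mul, mul_assoc]
  gcongr
  exact h' j

theorem Equivalent.trans {J : Type*} {α β γ : J → ℝ≥0∞} (h : Equivalent α β)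
    (h' : Equivalent β γ) : Equivalent α γ :=
  ⟨h.1.trans h'.1, h'.2.trans h.2⟩

/-! ### Consequences of the truncation quasi-greedy property. -/

namespace QBasis

variable {𝕜 X : Type*} [RCLike 𝕜] [AddCommGroup X] [Module 𝕜 X] {q : QuasiNorm 𝕜 X} {ι : Type*}

theorem norm_sgn (a : 𝕜) : ‖sgn a‖ = 1 := by
  unfold sgn
  split_ifs with h
  · simp
  · rw [norm_div, RCLike.norm_ofReal, abs_norm, div_self (norm_ne_zero_iff.2 h)]

/-- The coefficients of a vector tend to zero. -/
theorem finite_setOf_le_norm_coord (𝒳 : QBasis q ι) (f : X) {t : ℝ} (ht : 0 < t) :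
    {n | t ≤ ‖𝒳.coord n f‖}.Finite := by
  classical
  obtain ⟨C, hC, h⟩ := 𝒳.exists_coord_bound
  obtain ⟨A, a, hA⟩ := 𝒳.exists_approx f (ε := t / C) (by positivity)
  refine A.finite_toSet.subset fun n hn => ?_
  by_contra hnA
  have h1 := h n (f - ∑ n ∈ A, a n • 𝒳.vec n)
  rw [map_sub, coord_sum_smul_vec, if_neg (by simpa using hnA), sub_zero] at h1
  have h2 : C * q (f - ∑ n ∈ A, a n • 𝒳.vec n) < C * (t / C) := by gcongr
  rw [mul_div_cancel₀ _ hC.ne'] at h2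
  have : t ≤ ‖𝒳.coord n f‖ := hn
  linarith

/-- In a truncation quasi-greedy basis, sums over a set on which the coefficients of `f` are
bounded below are controlled by `f`. -/
theorem IsTruncationQuasiGreedy.exists_bound [Encodable ι] {𝒴 : QBasis q ι}
    (h : 𝒴.IsTruncationQuasiGreedy) :
    ∃ C : ℝ, 0 < C ∧ ∀ (f : X) (A : Finset ι) (t : ℝ) (a : ι → 𝕜), 0 ≤ t →
      (∀ n ∈ A, t ≤ ‖𝒴.coord n f‖) → (∀ n ∈ A, ‖a n‖ ≤ 1) →
        t * q (∑ n ∈ A, a n • 𝒴.vec n) ≤ C * q f := by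
  classical
  obtain ⟨C₀, h₀⟩ := h
  obtain ⟨C₁, hC₁, h₁⟩ := q.exists_forall_sum_smul_le ι
  obtain ⟨κ, hκ1, hκ⟩ := q.exists_one_le_concavity
  set C := max C₀ 1 with hC
  have hCp : 0 < C := by positivity
  have h₀' : ∀ (f : X) (A : Finset ι) (hA : A.Nonempty), 𝒴.IsGreedySet f A → ∀ t : ℝ, 0 ≤ t →
      (∀ n ∈ A, t ≤ ‖𝒴.coord n f‖) →
      t * q (∑ n ∈ A, sgn (𝒴.coord n f) • 𝒴.vec n) ≤ C * q f := by
    intro f A hA hg t ht htA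
    have h2 : t ≤ A.inf' hA (fun n => ‖𝒴.coord n f‖) := Finset.le_inf' _ _ htA
    have h1 := h₀ f A hA hg
    rw [truncation, q.smul, RCLike.norm_ofReal, abs_of_nonneg (ht.trans h2)] at h1
    exact (mul_le_mul_of_nonneg_right h2 (q.nonneg _)).trans
      (h1.trans (mul_le_mul_of_nonneg_right (le_max_left _ _) (q.nonneg _)))
  -- suppression unconditionality for constant coefficients
  have hsucc : ∀ (A B : Finset ι) (ε : ι → 𝕜), (∀ n, ‖ε n‖ = 1) → A ⊆ B →
      q (∑ n ∈ A, ε n • 𝒴.vec n) ≤ 2 * C * κ * q (∑ n ∈ B, ε n • 𝒴.vec n) := by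
    intro A B ε hε hAB
    rcases A.eq_empty_or_nonempty with rfl | hA
    · rw [Finset.sum_empty, q.map_zero]
      exact mul_nonneg (by positivity) (q.nonneg _)
    -- Adding `s` times the sum over `A` makes `A` the strict greedy set of `g`; with this `s` the
    -- extra term costs half of the left-hand side and is absorbed.
    set s : ℝ := 1 / (2 * C * κ) with hs
    have hs0 : 0 < s := by positivity
    set g : X := ∑ n ∈ B, ε n • 𝒴.vec n + (s : 𝕜) • ∑ n ∈ A, ε n • 𝒴.vec n with hgdef
    have hg : ∀ n, 𝒴.coord n g = if n ∈ A then ((1 + s : ℝ) : 𝕜) * ε n else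
        if n ∈ B then ε n else 0 := by
      intro n
      rw [hgdef, map_add, map_smul, coord_sum_smul_vec, coord_sum_smul_vec]
      by_cases hn : n ∈ A
      · simp [hn, hAB hn]; ring
      · simp [hn]
    have hgA : ∀ n ∈ A, ‖𝒴.coord n g‖ = 1 + s := by
      intro n hn
      rw [hg, if_pos hn, norm_mul, hε, mul_one, RCLike.norm_ofReal, abs_of_pos (by positivity)]
    have hgr : 𝒴.IsGreedySet g A := by
      intro i hi j hj
      left
      rw [hgA i hi, hg, if_neg hj]
      split_ifs
      · rw [hε]; linarith
      · rw [norm_zero]; linarith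
    have h1 := h₀' g A hA hgr 1 zero_le_one fun n hn => by rw [hgA n hn]; linarith
    have h2 : ∑ n ∈ A, sgn (𝒴.coord n g) • 𝒴.vec n = ∑ n ∈ A, ε n • 𝒴.vec n := by
      refine Finset.sum_congr rfl fun n hn => ?_
      have hne : 𝒴.coord n g ≠ 0 := by
        rw [← norm_ne_zero_iff, hgA n hn]; positivity
      have hs1 : ((1 + s : ℝ) : 𝕜) ≠ 0 := RCLike.ofReal_ne_zero.2 (by positivity)
      rw [sgn, if_neg hne, hgA n hn, hg, if_pos hn, mul_div_cancel_left₀ _ hs1]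
    rw [h2, one_mul] at h1
    have h3 := hκ (∑ n ∈ B, ε n • 𝒴.vec n) ((s : 𝕜) • ∑ n ∈ A, ε n • 𝒴.vec n)
    rw [← hgdef, q.smul, RCLike.norm_ofReal, abs_of_pos hs0] at h3
    have h4 := h1.trans (mul_le_mul_of_nonneg_left h3 hCp.le)
    have h5 : C * (κ * (q (∑ n ∈ B, ε n • 𝒴.vec n) + s * q (∑ n ∈ A, ε n • 𝒴.vec n))) =
        C * κ * q (∑ n ∈ B, ε n • 𝒴.vec n) + q (∑ n ∈ A, ε n • 𝒴.vec n) / 2 := by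
      rw [hs]; field_simp
    linarith
  refine ⟨C₁ * (2 * C * κ * C), by positivity, fun f A t a ht htA ha => ?_⟩
  rcases ht.eq_or_lt with rfl | ht
  · rw [zero_mul]; exact mul_nonneg (by positivity) (q.nonneg _)
  rcases A.eq_empty_or_nonempty with rfl | hA
  · rw [Finset.sum_empty, q.map_zero, mul_zero]
    exact mul_nonneg (by positivity) (q.nonneg _)
  -- The full superlevel set is greedy however ties are broken. Suppression then descends to subsets
  -- of `A`, and `h₁` replaces signs by arbitrary coefficients.
  set B := (𝒴.finite_setOf_le_norm_coord f ht).toFinset with hB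
  have hmB : ∀ n, n ∈ B ↔ t ≤ ‖𝒴.coord n f‖ := fun n => by simp [hB]
  have hAB : A ⊆ B := fun n hn => (hmB n).2 (htA n hn)
  have hgr : 𝒴.IsGreedySet f B := fun i hi j hj =>
    Or.inl ((not_le.1 (mt (hmB j).2 hj)).trans_le ((hmB i).1 hi))
  set ε : ι → 𝕜 := fun n => sgn (𝒴.coord n f) with hε
  have hε0 : ∀ n, ε n ≠ 0 := fun n => by rw [← norm_ne_zero_iff, hε, norm_sgn]; exact one_ne_zero
  have h1 := h₀' f B (hA.mono hAB) hgr t ht.le fun n hn => (hmB n).1 hn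
  have h2 := h₁ A (fun n => ε n • 𝒴.vec n) (2 * C * κ * q (∑ n ∈ B, ε n • 𝒴.vec n))
    (fun A' hA' => hsucc A' B ε (fun n => norm_sgn _) (hA'.trans hAB))
    (fun n => a n / ε n) (fun n hn => by rw [norm_div, hε, norm_sgn, div_one]; exact ha n hn)
  have h3 : ∑ n ∈ A, (a n / ε n) • ε n • 𝒴.vec n = ∑ n ∈ A, a n • 𝒴.vec n :=
    Finset.sum_congr rfl fun n _ => by rw [smul_smul, div_mul_cancel₀ _ (hε0 n)]
  rw [h3] at h2
  calc t * q (∑ n ∈ A, a n • 𝒴.vec n) ≤ t * _ := mul_le_mul_of_nonneg_left h2 ht.le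
    _ = C₁ * (2 * C * κ) * (t * q (∑ n ∈ B, ε n • 𝒴.vec n)) := by ring
    _ ≤ C₁ * (2 * C * κ) * (C * q f) := mul_le_mul_of_nonneg_left h1 (by positivity)
    _ = _ := by ring

end QBasis

/-! ### Abstract form of the two hypotheses, and averaging tools. -/

/-- The basis is squeezed between symmetric spaces with fundamental function `Φ`, where `1 / Φ` is
summable. -/
structure QBasis.IsSqueezedBy {𝕜 X : Type*} [RCLike 𝕜] [AddCommGroup X] [Module 𝕜 X]
    {q : QuasiNorm 𝕜 X} {ι : Type*} (𝒳 : QBasis q ι) (Φ : ℕ → ℝ) : Prop where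
  mono : Monotone Φ
  nonneg : ∀ m, 0 ≤ Φ m
  pos : ∀ m, m ≠ 0 → 0 < Φ m
  summable : Summable fun m => (Φ m)⁻¹
  mul_le : ∀ k : ℕ, ∃ C : ℝ, 0 < C ∧ ∀ m, Φ (k * m) ≤ C * Φ m
  upper : ∃ C : ℝ, 0 < C ∧ ∀ (A : Finset ι) (a : ι → 𝕜), (∀ n ∈ A, ‖a n‖ ≤ 1) →
    q (∑ n ∈ A, a n • 𝒳.vec n) ≤ C * Φ A.card
  lower : ∃ C : ℝ, 0 < C ∧ ∀ (f : X) (A : Finset ι) (t : ℝ), (∀ n ∈ A, t ≤ ‖𝒳.coord n f‖) →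
    t * Φ A.card ≤ C * q f

/-- A biorthogonal system in which constant-coefficient sums over sets where the coefficients of a
vector are bounded below are controlled by that vector. -/
structure IsTruncationSystem {𝕜 X : Type*} [RCLike 𝕜] [AddCommGroup X] [Module 𝕜 X]
    (q : QuasiNorm 𝕜 X) {ι : Type*} (y : ι → X) (u : ι → X →ₗ[𝕜] 𝕜) : Prop where
  vec_bounded : ∃ C : ℝ, 0 < C ∧ ∀ j, q (y j) ≤ C
  dual_bounded : ∃ C : ℝ, 0 < C ∧ ∀ j f, ‖u j f‖ ≤ C * q f
  self : ∀ j, u j (y j) = 1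
  ne : ∀ i j, i ≠ j → u i (y j) = 0
  truncation : ∃ C : ℝ, 0 < C ∧ ∀ (f : X) (A : Finset ι) (t : ℝ) (a : ι → 𝕜), 0 ≤ t →
      (∀ n ∈ A, t ≤ ‖u n f‖) → (∀ n ∈ A, ‖a n‖ ≤ 1) → t * q (∑ n ∈ A, a n • y n) ≤ C * q f

/-- `M` is chosen from the tail of `∑ 1 / Φ` alone, hence is uniform in the family and in `B`. -/
theorem exists_forall_exists_subset_sum_sdiff_le (ι : Type*) [DecidableEq ι] {Φ : ℕ → ℝ}
    (hpos : ∀ m, m ≠ 0 → 0 < Φ m) (hsum : Summable fun m => (Φ m)⁻¹) {K η : ℝ} (hK : 0 < K)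
    (hη : 0 < η) : ∃ M : ℕ, ∀ a : ι → ℝ,
      (∀ (A : Finset ι) (t : ℝ), (∀ n ∈ A, t ≤ a n) → t * Φ A.card ≤ K) →
      ∀ B : Finset ι, ∃ F ⊆ B, F.card ≤ M ∧ ∑ n ∈ B \ F, a n ≤ η := by
  obtain ⟨s, hs⟩ := summable_iff_vanishing_norm.1 hsum (η / K) (by positivity)
  refine ⟨s.sup id, fun a ha B => ?_⟩
  obtain ⟨F, hF, hFc, h⟩ := exists_subset_sum_sdiff_le hpos ha (s.sup id) B
  refine ⟨F, hF, hFc, h.trans ?_⟩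
  have h1 := hs (Finset.Ioc (s.sup id) B.card) (Finset.disjoint_left.2 fun m hm hms => by
    have := Finset.le_sup (f := id) hms
    simp only [Finset.mem_Ioc, id] at hm this
    omega)
  calc K * ∑ m ∈ Finset.Ioc (s.sup id) B.card, (Φ m)⁻¹ ≤ K * (η / K) := by
        gcongr
        exact (le_abs_self _).trans h1.le
    _ = η := by field_simp

theorem sum_le_mul_tsum_inv {ι : Type*} {Φ : ℕ → ℝ} (hnn : ∀ m, 0 ≤ Φ m)
    (hpos : ∀ m, m ≠ 0 → 0 < Φ m) (hsum : Summable fun m => (Φ m)⁻¹) {K : ℝ} (hK : 0 ≤ K)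
    {a : ι → ℝ} (ha : ∀ (A : Finset ι) (t : ℝ), (∀ n ∈ A, t ≤ a n) → t * Φ A.card ≤ K)
    (B : Finset ι) : ∑ n ∈ B, a n ≤ K * ∑' m, (Φ m)⁻¹ := by
  classical
  obtain ⟨F, hF, hFc, h⟩ := exists_subset_sum_sdiff_le hpos ha 0 B
  rw [Finset.card_eq_zero.1 (Nat.le_zero.1 hFc), Finset.sdiff_empty] at h
  exact h.trans (mul_le_mul_of_nonneg_left
    (hsum.sum_le_tsum _ fun m _ => inv_nonneg.2 (hnn m)) hK)

/-- The sums over `S` and `insert i S` differ by a term of norm at least `δ`, so one of them has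
norm at least `δ / 2`. Thus each `n` is good for at least half of the subsets, and some subset is
good for at least half of `T`. -/
theorem exists_powerset_card_filter_le {τ ι E : Type*} [DecidableEq ι] [SeminormedAddCommGroup E]
    (T : Finset τ) (A : Finset ι) (c : τ → ι → E) (δ : ℝ)
    (h : ∀ n ∈ T, ∃ i ∈ A, δ ≤ ‖c n i‖) :
    ∃ S ⊆ A, T.card ≤ 2 * (T.filter fun n => δ / 2 ≤ ‖∑ j ∈ S, c n j‖).card := by
  classical
  have key : ∀ n ∈ T, 2 ^ A.card ≤
      2 * ∑ S ∈ A.powerset, if δ / 2 ≤ ‖∑ j ∈ S, c n j‖ then 1 else 0 := by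
    intro n hn
    obtain ⟨i, hi, hδ⟩ := h n hn
    rw [← Finset.insert_erase hi, Finset.sum_powerset_insert (Finset.notMem_erase i A),
      Finset.card_insert_of_notMem (Finset.notMem_erase i A), pow_succ', ← Finset.card_powerset,
      ← Finset.sum_add_distrib]
    refine Nat.mul_le_mul_left 2 ?_
    rw [Finset.card_eq_sum_ones]
    refine Finset.sum_le_sum fun S hS => ?_
    have hiS : i ∉ S := fun hiS => Finset.notMem_erase i A (Finset.mem_powerset.1 hS hiS)
    rw [Finset.sum_insert hiS]
    by_contra! hlt
    have h1 : ¬ δ / 2 ≤ ‖∑ j ∈ S, c n j‖ := fun h => by rw [if_pos h] at hlt; omega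
    have h2 : ¬ δ / 2 ≤ ‖c n i + ∑ j ∈ S, c n j‖ := fun h => by rw [if_pos h] at hlt; omega
    have h3 := norm_sub_le (c n i + ∑ j ∈ S, c n j) (∑ j ∈ S, c n j)
    rw [add_sub_cancel_right] at h3
    linarith
  have h1 : ∑ _S ∈ A.powerset, T.card ≤ ∑ S ∈ A.powerset,
      2 * (T.filter fun n => δ / 2 ≤ ‖∑ j ∈ S, c n j‖).card := by
    rw [Finset.sum_const, Finset.card_powerset, smul_eq_mul, ← Finset.mul_sum, mul_comm]
    simp only [Finset.card_filter]
    rw [Finset.sum_comm, Finset.mul_sum, ← smul_eq_mul]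
    exact Finset.card_nsmul_le_sum _ _ _ key
  obtain ⟨S, hS, h2⟩ := Finset.exists_le_of_sum_le ⟨∅, by simp⟩ h1
  exact ⟨S, Finset.mem_powerset.1 hS, h2⟩

/-! ### Comparison of a squeezed basis with a truncation system. -/

namespace QBasis.IsSqueezedBy

variable {𝕜 X : Type*} [RCLike 𝕜] [AddCommGroup X] [Module 𝕜 X] {q : QuasiNorm 𝕜 X} {ι κ : Type*}
  {𝒳 : QBasis q ι} {Φ : ℕ → ℝ} {y : κ → X} {u : κ → X →ₗ[𝕜] 𝕜}

/-- The coefficient transform is bounded into `ℓ₁`. -/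
theorem exists_sum_norm_coord_le (h : 𝒳.IsSqueezedBy Φ) :
    ∃ C : ℝ, 0 < C ∧ ∀ (f : X) (B : Finset ι), ∑ n ∈ B, ‖𝒳.coord n f‖ ≤ C * q f := by
  obtain ⟨C, hC, hl⟩ := h.lower
  have hs : 0 ≤ ∑' m, (Φ m)⁻¹ := tsum_nonneg fun m => inv_nonneg.2 (h.nonneg m)
  refine ⟨C * (∑' m, (Φ m)⁻¹ + 1), by positivity, fun f B => ?_⟩
  have h1 := sum_le_mul_tsum_inv h.nonneg h.pos h.summable (mul_nonneg hC.le (q.nonneg f))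
    (hl f) B
  have h2 := mul_nonneg hC.le (q.nonneg f)
  linarith

/-- A bounded functional is determined by its values on the basis. -/
theorem eventually_norm_sub_sum_le (h : 𝒳.IsSqueezedBy Φ) {v : X →ₗ[𝕜] 𝕜} {C : ℝ} (hC : 0 < C)
    (hv : ∀ f, ‖v f‖ ≤ C * q f) (f : X) {ε : ℝ} (hε : 0 < ε) :
    ∀ᶠ B : Finset ι in Filter.atTop,
      ‖v f - ∑ n ∈ B, 𝒳.coord n f * v (𝒳.vec n)‖ ≤ ε := by
  classical
  obtain ⟨C₁, hC₁, h₁⟩ := h.exists_sum_norm_coord_le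
  obtain ⟨C₂, hC₂, h₂⟩ := 𝒳.exists_vec_bound
  set D := C + C₁ * (C * C₂) with hD
  have hDp : 0 < D := by positivity
  obtain ⟨A, a, hA⟩ := 𝒳.exists_approx f (ε := ε / D) (by positivity)
  filter_upwards [Filter.eventually_ge_atTop A] with B hB
  set g := ∑ n ∈ A, a n • 𝒳.vec n with hg
  -- The expansion is exact on the finite combination `g`; the `ℓ₁` bound controls it on `f - g`
  -- uniformly in `B`.
  have hvg : v g = ∑ n ∈ B, 𝒳.coord n g * v (𝒳.vec n) := by
    have hcg : ∀ n, 𝒳.coord n g = if n ∈ A then a n else 0 := 𝒳.coord_sum_smul_vec A a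
    simp only [hcg, ite_mul, zero_mul]
    rw [Finset.sum_ite_mem, Finset.inter_eq_right.2 hB, hg]
    simp
  have h3 : v f - ∑ n ∈ B, 𝒳.coord n f * v (𝒳.vec n) =
      v (f - g) - ∑ n ∈ B, 𝒳.coord n (f - g) * v (𝒳.vec n) := by
    simp only [map_sub, sub_mul, Finset.sum_sub_distrib]
    rw [← hvg]; ring
  rw [h3]
  have h4 : ‖∑ n ∈ B, 𝒳.coord n (f - g) * v (𝒳.vec n)‖ ≤ C₁ * q (f - g) * (C * C₂) := by
    refine (norm_sum_le _ _).trans (le_trans ?_ (mul_le_mul_of_nonneg_right (h₁ (f - g) B)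
      (by positivity)))
    rw [Finset.sum_mul]
    refine Finset.sum_le_sum fun n _ => ?_
    rw [norm_mul]
    gcongr
    exact (hv _).trans (by gcongr; exact h₂ n)
  calc _ ≤ C * q (f - g) + C₁ * q (f - g) * (C * C₂) :=
        (norm_sub_le _ _).trans (add_le_add (hv _) h4)
    _ = D * q (f - g) := by rw [hD]; ring
    _ ≤ D * (ε / D) := by gcongr
    _ = ε := by field_simp

/-- The coefficients of a bounded family are uniformly concentrated on few indices. -/
theorem exists_forall_exists_subset_sum_sdiff_norm_coord_le [DecidableEq ι]
    (h : 𝒳.IsSqueezedBy Φ) {C η : ℝ} (hC : 0 < C) (hη : 0 < η) :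
    ∃ M : ℕ, ∀ f, q f ≤ C → ∀ B : Finset ι, ∃ F ⊆ B, F.card ≤ M ∧
      ∑ n ∈ B \ F, ‖𝒳.coord n f‖ ≤ η := by
  obtain ⟨C₁, hC₁, hl⟩ := h.lower
  obtain ⟨M, hM⟩ := exists_forall_exists_subset_sum_sdiff_le ι h.pos h.summable
    (mul_pos hC₁ hC) hη
  exact ⟨M, fun f hf B => hM (fun n => ‖𝒳.coord n f‖) (fun A t htA => (hl f A t htA).trans
    (mul_le_mul_of_nonneg_left hf hC₁.le)) B⟩

/-- Expand `1 = u j (y j)` along `𝒳`. Cutting to finitely many indices and then to `M` of them costs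
`1 / 4` each, so one of the `M` products is bounded below. Both factors are bounded above, hence
both are bounded below. -/
theorem exists_forall_exists_le_norm_coord (h : 𝒳.IsSqueezedBy Φ) (hy : IsTruncationSystem q y u) :
    ∃ δ : ℝ, 0 < δ ∧ ∀ j, ∃ n, δ ≤ ‖𝒳.coord n (y j)‖ ∧ δ ≤ ‖u j (𝒳.vec n)‖ := by
  classical
  obtain ⟨C₁, hC₁, h₁⟩ := hy.vec_bounded
  obtain ⟨C₂, hC₂, h₂⟩ := hy.dual_bounded
  obtain ⟨C₃, hC₃, h₃⟩ := 𝒳.exists_vec_bound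
  obtain ⟨C₄, hC₄, h₄⟩ := 𝒳.exists_coord_bound
  have hL : ∀ n j, ‖𝒳.coord n (y j)‖ ≤ C₄ * C₁ := fun n j =>
    (h₄ _ _).trans (by gcongr; exact h₁ j)
  have hM : ∀ n j, ‖u j (𝒳.vec n)‖ ≤ C₂ * C₃ := fun n j =>
    (h₂ _ _).trans (by gcongr; exact h₃ n)
  obtain ⟨M, hF⟩ := h.exists_forall_exists_subset_sum_sdiff_norm_coord_le hC₁
    (η := 1 / (4 * (C₂ * C₃))) (by positivity)
  set δ : ℝ := 1 / (2 * (M + 1)) with hδ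
  have hδ0 : 0 < δ := by positivity
  refine ⟨min (δ / (C₂ * C₃)) (δ / (C₄ * C₁)), by positivity, fun j => ?_⟩
  obtain ⟨B, hB⟩ := (h.eventually_norm_sub_sum_le hC₂ (h₂ j) (y j)
    (ε := 1 / 4) (by norm_num)).exists
  obtain ⟨F, hFB, hFM, hFs⟩ := hF (y j) (h₁ j) B
  obtain ⟨n, hn⟩ : ∃ n, δ ≤ ‖𝒳.coord n (y j)‖ * ‖u j (𝒳.vec n)‖ := by
    by_contra! hlt
    rw [hy.self, ← Finset.sum_sdiff hFB] at hB
    have h5 : ‖∑ n ∈ F, 𝒳.coord n (y j) * u j (𝒳.vec n)‖ ≤ M * δ := by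
      refine (norm_sum_le _ _).trans ?_
      refine (Finset.sum_le_card_nsmul F _ δ fun n _ => ?_).trans ?_
      · rw [norm_mul]; exact (hlt n).le
      · rw [nsmul_eq_mul]; gcongr
    have h6 : ‖∑ n ∈ B \ F, 𝒳.coord n (y j) * u j (𝒳.vec n)‖ ≤ 1 / 4 := by
      calc _ ≤ ∑ n ∈ B \ F, ‖𝒳.coord n (y j)‖ * (C₂ * C₃) := by
            refine (norm_sum_le _ _).trans (Finset.sum_le_sum fun n _ => ?_)
            rw [norm_mul]; gcongr; exact hM n j
        _ ≤ 1 / (4 * (C₂ * C₃)) * (C₂ * C₃) := by rw [← Finset.sum_mul]; gcongr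
        _ = 1 / 4 := by field_simp
    have h7 : (M : ℝ) * δ < 1 / 2 := by
      rw [hδ, mul_one_div, div_lt_div_iff₀ (by positivity) (by norm_num)]
      linarith
    have h8 := norm_sub_norm_le (1 : 𝕜) (∑ n ∈ B \ F, 𝒳.coord n (y j) * u j (𝒳.vec n) +
      ∑ n ∈ F, 𝒳.coord n (y j) * u j (𝒳.vec n))
    have h9 := norm_add_le (∑ n ∈ B \ F, 𝒳.coord n (y j) * u j (𝒳.vec n))
      (∑ n ∈ F, 𝒳.coord n (y j) * u j (𝒳.vec n))
    rw [norm_one] at h8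
    linarith
  refine ⟨n, (min_le_left _ _).trans ?_, (min_le_right _ _).trans ?_⟩
  · rw [div_le_iff₀ (by positivity)]
    exact hn.trans (by gcongr; exact hM n j)
  · rw [div_le_iff₀ (by positivity), mul_comm]
    exact hn.trans (by gcongr; exact hL n j)

/-- Truncation applied to `𝒳.vec n` bounds `∑ j ∈ A, a j • y j`. With `a j` the conjugate signs of
`𝒳.coord n (y j)`, the `n`-th coefficient of this sum is at least `δ |A|`. -/
theorem exists_card_le (𝒳 : QBasis q ι) (hy : IsTruncationSystem q y u) {δ : ℝ} (hδ : 0 < δ) :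
    ∃ N : ℕ, ∀ (A : Finset κ) (n : ι),
      (∀ j ∈ A, δ ≤ ‖𝒳.coord n (y j)‖ ∧ δ ≤ ‖u j (𝒳.vec n)‖) → A.card ≤ N := by
  obtain ⟨C₃, hC₃, h₃⟩ := 𝒳.exists_vec_bound
  obtain ⟨C₄, hC₄, h₄⟩ := 𝒳.exists_coord_bound
  obtain ⟨C, hC, ht⟩ := hy.truncation
  refine ⟨⌈C₄ * (C * C₃ / δ) / δ⌉₊, fun A n hA => ?_⟩
  set a : κ → 𝕜 := fun j => (starRingEnd 𝕜) (𝒳.coord n (y j)) / (‖𝒳.coord n (y j)‖ : ℝ) with ha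
  have ha1 : ∀ j ∈ A, ‖a j‖ ≤ 1 := by
    intro j _
    rw [ha, norm_div, RCLike.norm_conj, RCLike.norm_ofReal, abs_norm]
    exact div_self_le_one _
  have h1 := ht (𝒳.vec n) A δ a hδ.le (fun j hj => (hA j hj).2) ha1
  have h2 : 𝒳.coord n (∑ j ∈ A, a j • y j) = ((∑ j ∈ A, ‖𝒳.coord n (y j)‖ : ℝ) : 𝕜) := by
    rw [map_sum, RCLike.ofReal_sum]
    refine Finset.sum_congr rfl fun j hj => ?_
    have hne : ((‖𝒳.coord n (y j)‖ : ℝ) : 𝕜) ≠ 0 :=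
      RCLike.ofReal_ne_zero.2 (hδ.trans_le (hA j hj).1).ne'
    rw [map_smul, smul_eq_mul, ha, div_mul_eq_mul_div, RCLike.conj_mul, sq, mul_div_cancel_left₀ _ hne]
  have h3 := h₄ n (∑ j ∈ A, a j • y j)
  rw [h2, RCLike.norm_ofReal] at h3
  have h4 : A.card * δ ≤ ∑ j ∈ A, ‖𝒳.coord n (y j)‖ := by
    rw [← nsmul_eq_mul]
    exact Finset.card_nsmul_le_sum _ _ _ fun j hj => (hA j hj).1
  have h5 : q (∑ j ∈ A, a j • y j) ≤ C * C₃ / δ := by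
    rw [le_div_iff₀ hδ, mul_comm]
    exact h1.trans (by gcongr; exact h₃ n)
  have h6 : (A.card : ℝ) ≤ C₄ * (C * C₃ / δ) / δ := by
    rw [le_div_iff₀ hδ]
    exact (h4.trans (le_abs_self _)).trans (h3.trans (by gcongr))
  have h7 := h6.trans (Nat.le_ceil _)
  exact_mod_cast h7

/-- Were `ι` finite, infinitely many `j` would share one index `n j`. -/
theorem infinite_index [Infinite κ] (h : 𝒳.IsSqueezedBy Φ) (hy : IsTruncationSystem q y u) :
    Infinite ι := by
  obtain ⟨δ, hδ, hn⟩ := h.exists_forall_exists_le_norm_coord hy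
  choose n hn using hn
  obtain ⟨N, hN⟩ := exists_card_le 𝒳 hy hδ
  by_contra hfin
  rw [not_infinite_iff_finite] at hfin
  obtain ⟨i, hi⟩ := Finite.exists_infinite_fiber n
  obtain ⟨A, hA⟩ := Infinite.exists_subset_card_eq (n ⁻¹' {i}) (N + 1)
  have := hN (A.map (Function.Embedding.subtype _)) i (by
    intro j hj
    obtain ⟨k, -, rfl⟩ := Finset.mem_map.1 hj
    have hk : n k = i := k.2
    have hk' := hn k
    rwa [hk] at hk')
  rw [Finset.card_map] at this
  omega

/-- The lower estimate for the norms of the sums of a truncation system. -/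
theorem exists_le_norm_sum (h : 𝒳.IsSqueezedBy Φ) (hy : IsTruncationSystem q y u) :
    ∃ C : ℝ, 0 < C ∧ ∀ A : Finset κ, Φ A.card ≤ C * q (∑ j ∈ A, y j) := by
  classical
  obtain ⟨δ, hδ, hn⟩ := h.exists_forall_exists_le_norm_coord hy
  choose n hn using hn
  obtain ⟨N, hN⟩ := exists_card_le 𝒳 hy hδ
  obtain ⟨C₁, hC₁, h₁⟩ := h.mul_le (N * 2)
  obtain ⟨C₂, hC₂, h₂⟩ := h.lower
  obtain ⟨C₃, hC₃, h₃⟩ := hy.truncation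
  refine ⟨C₁ * (2 / δ * (C₂ * C₃)), by positivity, fun A => ?_⟩
  obtain ⟨S, hS, hcard⟩ := exists_powerset_card_filter_le (A.image n) A
    (fun m j => 𝒳.coord m (y j)) δ (fun m hm => by
      obtain ⟨j, hj, rfl⟩ := Finset.mem_image.1 hm
      exact ⟨j, hj, (hn j).1⟩)
  set G := (A.image n).filter fun m => δ / 2 ≤ ‖∑ j ∈ S, 𝒳.coord m (y j)‖ with hG
  have hAG : A.card ≤ N * 2 * G.card := by
    have h1 : A.card ≤ N * (A.image n).card :=
      Finset.card_le_mul_card_image A N fun m _ => hN _ m fun j hj => by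
        rw [← (Finset.mem_filter.1 hj).2]; exact hn j
    calc A.card ≤ N * (A.image n).card := h1
      _ ≤ N * (2 * G.card) := Nat.mul_le_mul_left _ hcard
      _ = _ := by ring
  have h4 := h₂ (∑ j ∈ S, y j) G (δ / 2) fun m hm => by
    rw [map_sum]; exact (Finset.mem_filter.1 hm).2
  -- The sum over `A` has coefficients `1` on `S`, so it dominates the sum over `S`.
  have h5 := h₃ (∑ j ∈ A, y j) S 1 (fun _ => 1) zero_le_one (fun j hj => by
    rw [map_sum, Finset.sum_eq_single_of_mem j (hS hj) fun i _ hij => hy.ne j i hij.symm, hy.self]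
    simp) (by simp)
  simp only [one_smul, one_mul] at h5
  calc Φ A.card ≤ Φ (N * 2 * G.card) := h.mono hAG
    _ ≤ C₁ * Φ G.card := h₁ _
    _ = C₁ * (2 / δ * (δ / 2 * Φ G.card)) := by field_simp
    _ ≤ C₁ * (2 / δ * (C₂ * (C₃ * q (∑ j ∈ A, y j)))) := by
      refine mul_le_mul_of_nonneg_left (mul_le_mul_of_nonneg_left ?_ (by positivity)) hC₁.le
      exact h4.trans (mul_le_mul_of_nonneg_left h5 hC₂.le)
    _ = _ := by ring

/-- The coefficient transform of a truncation system is bounded into `ℓ₁`. -/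
theorem exists_sum_norm_dual_le (h : 𝒳.IsSqueezedBy Φ) (hy : IsTruncationSystem q y u) :
    ∃ C : ℝ, 0 < C ∧ ∀ (f : X) (A : Finset κ), ∑ j ∈ A, ‖u j f‖ ≤ C * q f := by
  obtain ⟨C₁, hC₁, h₁⟩ := h.exists_le_norm_sum hy
  obtain ⟨C₂, hC₂, h₂⟩ := hy.truncation
  have hs : 0 ≤ ∑' m, (Φ m)⁻¹ := tsum_nonneg fun m => inv_nonneg.2 (h.nonneg m)
  refine ⟨C₁ * C₂ * (∑' m, (Φ m)⁻¹ + 1), by positivity, fun f A => ?_⟩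
  have h0 : 0 ≤ C₁ * C₂ * q f := mul_nonneg (by positivity) (q.nonneg f)
  have h1 := sum_le_mul_tsum_inv h.nonneg h.pos h.summable (a := fun j => ‖u j f‖) h0
    -- Truncation and the lower estimate put the coefficients `u j f` in the weak space of `Φ`.
    (fun B t htB => by
      rcases le_total t 0 with ht | ht
      · exact (mul_nonpos_of_nonpos_of_nonneg ht (h.nonneg _)).trans h0
      · have h3 := h₂ f B t (fun _ => 1) ht htB (by simp)
        simp only [one_smul] at h3
        calc t * Φ B.card ≤ t * (C₁ * q (∑ j ∈ B, y j)) := mul_le_mul_of_nonneg_left (h₁ B) ht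
          _ = C₁ * (t * q (∑ j ∈ B, y j)) := by ring
          _ ≤ C₁ * (C₂ * q f) := by gcongr
          _ = _ := by ring) A
  linarith

/-- The upper estimate for the norms of the sums of a truncation system. -/
theorem exists_norm_sum_le (h : 𝒳.IsSqueezedBy Φ) (hy : IsTruncationSystem q y u) :
    ∃ C : ℝ, 0 < C ∧ ∀ A : Finset κ, q (∑ j ∈ A, y j) ≤ C * Φ A.card := by
  classical
  obtain ⟨C₁, hC₁, h₁⟩ := hy.vec_bounded
  obtain ⟨C₂, hC₂, h₂⟩ := hy.dual_bounded
  obtain ⟨C₃, hC₃, h₃⟩ := 𝒳.exists_vec_bound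
  obtain ⟨S, hS, hLs⟩ := h.exists_sum_norm_coord_le
  obtain ⟨S', hS', hMs⟩ := h.exists_sum_norm_dual_le hy
  obtain ⟨C₄, hC₄, h₄⟩ := h.upper
  obtain ⟨C₅, hC₅, h₅⟩ := hy.truncation
  -- Column bound for the stacked matrix: `S * C₁` for the cut coefficients, the rest for `η⁻¹ * E`.
  -- With `η = 1 / (16 * D)`, the row bound `8 * D` turns into `8 * D * η = 1 / 2` for `E`.
  set D : ℝ := S * C₁ + (1 + S' * C₃) with hD
  have hDp : 0 < D := by positivity
  set η : ℝ := 1 / (16 * D) with hη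
  have hη0 : 0 < η := by positivity
  obtain ⟨M, hF⟩ := h.exists_forall_exists_subset_sum_sdiff_norm_coord_le hC₁ hη0
  obtain ⟨C₆, hC₆, h₆⟩ := h.mul_le M
  refine ⟨2 * C₅ * (8 * D * (C₄ * C₆)), by positivity, fun A => ?_⟩
  -- One `B` for all pairs from `A`; the error `η / (A.card + 1)` still sums to at most `η` down a
  -- column.
  obtain ⟨B, hB⟩ : ∃ B : Finset ι, ∀ i ∈ A, ∀ j ∈ A,
      ‖u i (y j) - ∑ n ∈ B, 𝒳.coord n (y j) * u i (𝒳.vec n)‖ ≤ η / (A.card + 1) := by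
    refine Filter.Eventually.exists (f := Filter.atTop) ?_
    rw [Filter.eventually_all_finset]
    intro i _
    rw [Filter.eventually_all_finset]
    exact fun j _ => h.eventually_norm_sub_sum_le hC₂ (h₂ i) (y j) (by positivity)
  choose F hFB hFM hFs using fun j => hF (y j) (h₁ j) B
  let E : κ → κ → 𝕜 := fun i j => u i (y j) - ∑ n ∈ F j, 𝒳.coord n (y j) * u i (𝒳.vec n)
  have hE : ∀ j ∈ A, ∑ i ∈ A, ‖E i j‖ ≤ (1 + S' * C₃) * η := by
    intro j hj
    have h7 : ∀ i ∈ A, ‖E i j‖ ≤ η / (A.card + 1) +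
        ∑ n ∈ B \ F j, ‖𝒳.coord n (y j)‖ * ‖u i (𝒳.vec n)‖ := by
      intro i hi
      have h8 : E i j = (u i (y j) - ∑ n ∈ B, 𝒳.coord n (y j) * u i (𝒳.vec n)) +
          ∑ n ∈ B \ F j, 𝒳.coord n (y j) * u i (𝒳.vec n) := by
        rw [← Finset.sum_sdiff (hFB j)]; ring
      rw [h8]
      refine (norm_add_le _ _).trans (add_le_add (hB i hi j hj) ((norm_sum_le _ _).trans ?_))
      exact Finset.sum_le_sum fun n _ => (norm_mul _ _).le
    refine (Finset.sum_le_sum h7).trans ?_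
    rw [Finset.sum_add_distrib, Finset.sum_comm, Finset.sum_const, nsmul_eq_mul, add_mul, one_mul]
    refine add_le_add ?_ ?_
    · rw [mul_div_assoc', div_le_iff₀ (by positivity)]
      nlinarith
    · calc ∑ n ∈ B \ F j, ∑ i ∈ A, ‖𝒳.coord n (y j)‖ * ‖u i (𝒳.vec n)‖
          ≤ ∑ n ∈ B \ F j, ‖𝒳.coord n (y j)‖ * (S' * C₃) := by
            refine Finset.sum_le_sum fun n _ => ?_
            rw [← Finset.mul_sum]
            gcongr
            exact (hMs _ _).trans (by gcongr; exact h₃ n)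
        _ ≤ S' * C₃ * η := by
            rw [← Finset.sum_mul, mul_comm]
            gcongr
            exact hFs j
  let L : ι → κ → 𝕜 := fun n j => if n ∈ F j then 𝒳.coord n (y j) else 0
  -- A single choice of signs controls both the coefficients of `g` and the error in `u i g`.
  obtain ⟨ε, hε, hrow⟩ := exists_sign_norm_sum_mul_le (𝕜 := 𝕜) hDp
    (fun (r : B ⊕ A) j => Sum.elim (fun n : B => L n j) (fun i : A => ((η⁻¹ : ℝ) : 𝕜) * E i j) r)
    A (fun j hj => by
      simp only [Fintype.sum_sum_type, Sum.elim_inl, Sum.elim_inr]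
      refine add_le_add ?_ ?_
      · rw [Finset.sum_coe_sort B fun n => ‖L n j‖]
        refine le_trans (Finset.sum_le_sum fun n _ => ?_)
          ((hLs (y j) B).trans (mul_le_mul_of_nonneg_left (h₁ j) hS.le))
        by_cases hn : n ∈ F j <;> simp [L, hn]
      · rw [Finset.sum_coe_sort A fun i => ‖((η⁻¹ : ℝ) : 𝕜) * E i j‖]
        simp only [norm_mul, RCLike.norm_ofReal, abs_of_pos (inv_pos.2 hη0)]
        rw [← Finset.mul_sum, inv_mul_le_iff₀ hη0, mul_comm]
        exact hE j hj)
  have hε' : ∀ j, ‖((ε j : ℝ) : 𝕜)‖ = 1 := fun j => by rw [RCLike.norm_ofReal, hε]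
  let c : ι → 𝕜 := fun n => ∑ j ∈ A, (ε j : 𝕜) * L n j
  let G : Finset ι := A.biUnion F
  have hGB : G ⊆ B := Finset.biUnion_subset.2 fun j _ => hFB j
  have hc : ∀ n ∈ G, ‖c n‖ ≤ 8 * D := fun n hn => hrow (Sum.inl ⟨n, hGB hn⟩)
  have hEr : ∀ i ∈ A, ‖∑ j ∈ A, (ε j : 𝕜) * E i j‖ ≤ 1 / 2 := by
    intro i hi
    have h7 := hrow (Sum.inr ⟨i, hi⟩)
    simp only [Sum.elim_inr, mul_left_comm _ ((η⁻¹ : ℝ) : 𝕜)] at h7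
    rw [← Finset.mul_sum, norm_mul, RCLike.norm_ofReal, abs_of_pos (inv_pos.2 hη0),
      inv_mul_le_iff₀ hη0] at h7
    refine h7.trans (le_of_eq ?_)
    rw [hη]; field_simp; norm_num
  let g : X := ∑ n ∈ G, c n • 𝒳.vec n
  have hg : q g ≤ 8 * D * (C₄ * Φ G.card) := by
    have h7 := h₄ G (fun n => ((8 * D : ℝ) : 𝕜)⁻¹ * c n) fun n hn => by
      rw [norm_mul, norm_inv, RCLike.norm_ofReal, abs_of_pos (by positivity),
        inv_mul_le_iff₀ (by positivity), mul_one]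
      exact hc n hn
    have hne : ((8 * D : ℝ) : 𝕜) ≠ 0 := RCLike.ofReal_ne_zero.2 (by positivity)
    have h8 : g = ((8 * D : ℝ) : 𝕜) • ∑ n ∈ G, (((8 * D : ℝ) : 𝕜)⁻¹ * c n) • 𝒳.vec n := by
      rw [Finset.smul_sum]
      refine Finset.sum_congr rfl fun n _ => ?_
      rw [smul_smul, mul_inv_cancel_left₀ hne]
    rw [h8, q.smul, RCLike.norm_ofReal, abs_of_pos (by positivity)]
    gcongr
  have hug : ∀ i ∈ A, u i g = ε i - ∑ j ∈ A, (ε j : 𝕜) * E i j := by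
    intro i hi
    have h7 : ∀ j ∈ A, ∑ n ∈ G, L n j * u i (𝒳.vec n) = u i (y j) - E i j := by
      intro j hj
      have hFG : F j ⊆ G := Finset.subset_biUnion_of_mem F hj
      simp only [L, E, sub_sub_cancel, ite_mul, zero_mul]
      rw [Finset.sum_ite_mem, Finset.inter_eq_right.2 hFG]
    have h8 : u i g = ∑ j ∈ A, (ε j : 𝕜) * ∑ n ∈ G, L n j * u i (𝒳.vec n) := by
      simp only [g, c, map_sum, map_smul, smul_eq_mul, Finset.sum_mul, Finset.mul_sum, mul_assoc]
      exact Finset.sum_comm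
    rw [h8, Finset.sum_congr rfl fun j hj => by rw [h7 j hj, mul_sub], Finset.sum_sub_distrib,
      Finset.sum_eq_single_of_mem i hi fun j _ hij => by rw [hy.ne i j hij.symm, mul_zero],
      hy.self, mul_one]
  have h7 := h₅ g A (1 / 2) (fun _ => 1) (by norm_num) (fun i hi => by
    rw [hug i hi]
    have h8 := norm_sub_norm_le ((ε i : ℝ) : 𝕜) (∑ j ∈ A, (ε j : 𝕜) * E i j)
    rw [hε'] at h8
    linarith [hEr i hi]) (by simp)
  simp only [one_smul] at h7
  have hGc : G.card ≤ M * A.card := by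
    rw [mul_comm]
    exact Finset.card_biUnion_le_card_mul _ _ _ fun j _ => hFM j
  calc q (∑ j ∈ A, y j) = 2 * (1 / 2 * q (∑ j ∈ A, y j)) := by ring
    _ ≤ 2 * (C₅ * (8 * D * (C₄ * (C₆ * Φ A.card)))) := by
      refine mul_le_mul_of_nonneg_left (h7.trans ?_) zero_le_two
      refine mul_le_mul_of_nonneg_left (hg.trans ?_) hC₅.le
      gcongr
      exact (h.mono hGc).trans (h₆ _)
    _ = _ := by ring

end QBasis.IsSqueezedBy

/-! ### Assembly. -/

theorem QBasis.IsSqueezeSymmetric.isSqueezedBy {𝕜 X : Type*} [RCLike 𝕜] [AddCommGroup X]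
    [Module 𝕜 X] {q : QuasiNorm 𝕜 X} {ι : Type*} [DecidableEq ι] {𝒳 : QBasis q ι}
    (h : 𝒳.IsSqueezeSymmetric) (hsum : ∑' m : ℕ+, (upperDemocracy q 𝒳.vec m)⁻¹ < ∞) :
    𝒳.IsSqueezedBy (realUpperDemocracy q 𝒳.vec) := by
  have hx := 𝒳.vec_bounded
  obtain ⟨hpos, hsm⟩ := realUpperDemocracy_pos_and_summable hx hsum
  obtain ⟨⟨C₁, hC₁, h₁⟩, C₂, hC₂, h₂⟩ := h.exists_bounds
  refine ⟨realUpperDemocracy_mono hx, realUpperDemocracy_nonneg, hpos, hsm,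
    realUpperDemocracy_mul_le hx, ⟨C₁, hC₁, fun A a ha => ?_⟩, C₂, hC₂, fun f A t ht => ?_⟩
  · exact (h₁ A a ha).trans
      (mul_le_mul_of_nonneg_left (norm_sum_le_realUpperDemocracy hx le_rfl) hC₁.le)
  · have h0 : 0 ≤ C₂ * q f := mul_nonneg hC₂.le (q.nonneg f)
    rcases le_or_gt t 0 with ht0 | ht0
    · exact (mul_nonpos_of_nonpos_of_nonneg ht0 (realUpperDemocracy_nonneg _)).trans h0
    · rw [← le_div_iff₀' ht0]
      refine realUpperDemocracy_le (by positivity) fun B hB => ?_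
      rw [le_div_iff₀' ht0]
      exact h₂ f A B t ht0.le ht hB

/-- Composing with the projection extends the coordinate functionals of `𝒴` to all of `X`, so that
they can be evaluated at the vectors of `𝒳`. -/
theorem BasicSequence.IsComplemented.exists_isTruncationSystem {𝕜 X : Type*} [RCLike 𝕜]
    [AddCommGroup X] [Module 𝕜 X] {q : QuasiNorm 𝕜 X} {ι : Type*} [Encodable ι]
    {𝒴 : BasicSequence q ι} (h : 𝒴.IsComplemented) (ht : 𝒴.basis.IsTruncationQuasiGreedy) :
    ∃ u : ι → X →ₗ[𝕜] 𝕜, IsTruncationSystem q 𝒴.vec u := by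
  obtain ⟨P, ⟨C, hC⟩, hP⟩ := h
  have hPv : ∀ j, P (𝒴.vec j) = 𝒴.basis.vec j := fun j => by rw [← 𝒴.coe_basis_vec, hP]
  have hC' : ∀ f, (q.restrict (q.closedSpan 𝒴.vec)) (P f) ≤ max C 1 * q f := fun f =>
    (hC f).trans (mul_le_mul_of_nonneg_right (le_max_left _ _) (q.nonneg _))
  obtain ⟨C₁, hC₁, h₁⟩ := 𝒴.basis.exists_vec_bound
  obtain ⟨C₂, hC₂, h₂⟩ := 𝒴.basis.exists_coord_bound
  obtain ⟨C₃, hC₃, h₃⟩ := ht.exists_bound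
  refine ⟨fun j => 𝒴.basis.coord j ∘ₗ P, ⟨C₁, hC₁, fun j => ?_⟩,
    ⟨C₂ * max C 1, by positivity, fun j f => ?_⟩, fun j => ?_, fun i j hij => ?_,
    ⟨C₃ * max C 1, by positivity, fun f A t a ht0 htA ha => ?_⟩⟩
  · rw [← 𝒴.coe_basis_vec]; exact h₁ j
  · rw [mul_assoc]
    exact (h₂ j (P f)).trans (mul_le_mul_of_nonneg_left (hC' f) hC₂.le)
  · rw [LinearMap.comp_apply, hPv, 𝒴.basis.coord_vec_self]
  · rw [LinearMap.comp_apply, hPv, 𝒴.basis.coord_vec_of_ne i j hij]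
  · have h4 : ∑ n ∈ A, a n • 𝒴.vec n =
        ((∑ n ∈ A, a n • 𝒴.basis.vec n : q.closedSpan 𝒴.vec) : X) := by
      simp [𝒴.coe_basis_vec]
    rw [h4, mul_assoc]
    exact (h₃ (P f) A t a ht0 htA ha).trans (mul_le_mul_of_nonneg_left (hC' f) hC₃.le)

theorem mainTheorem4 {𝕜 X : Type*} [RCLike 𝕜] [AddCommGroup X] [Module 𝕜 X]
    (q : QuasiNorm 𝕜 X) (hq : q.IsComplete)
    {𝒩 : Type*} [Countable 𝒩] [DecidableEq 𝒩] (𝒳 : QBasis q 𝒩)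
    (h𝒳 : 𝒳.IsSqueezeSymmetric)
    (hsum : ∑' m : ℕ+, (upperDemocracy q 𝒳.vec m)⁻¹ < ∞)
    {ℳ : Type*} [Encodable ℳ] [Infinite ℳ] (𝒴 : BasicSequence q ℳ)
    (hcompl : 𝒴.IsComplemented) (htqg : 𝒴.basis.IsTruncationQuasiGreedy) :
    IsDemocratic q 𝒴.vec ∧
      Equivalent (lowerDemocracy q 𝒳.vec) (lowerDemocracy q 𝒴.vec) ∧
      Equivalent (lowerDemocracy q 𝒴.vec) (upperDemocracy q 𝒴.vec) ∧
      Equivalent (upperDemocracy q 𝒴.vec) (upperDemocracy q 𝒳.vec) := by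
  have hX := h𝒳.isSqueezedBy hsum
  obtain ⟨u, hy⟩ := hcompl.exists_isTruncationSystem htqg
  have := hX.infinite_index hy
  obtain ⟨C₁, hC₁, h₁⟩ := hX.exists_norm_sum_le hy
  obtain ⟨C₂, hC₂, h₂⟩ := hX.exists_le_norm_sum hy
  obtain ⟨C₃, hC₃, h₃⟩ := hX.lower
  -- For both families the sum over `A` has norm equivalent to `Φ |A|`, so all four functions are
  -- compared through `Φ`.
  obtain ⟨hYl, hYu⟩ := equivalent_lowerDemocracy_upperDemocracy hX.mono hC₁ hC₂ h₁ h₂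
  obtain ⟨hXl, hXu⟩ := equivalent_lowerDemocracy_upperDemocracy (q := q) (x := 𝒳.vec) hX.mono
    one_pos hC₃
    (fun A => by
      rw [one_mul]; exact norm_sum_le_realUpperDemocracy 𝒳.vec_bounded le_rfl)
    (fun A => by
      have := h₃ (∑ n ∈ A, 𝒳.vec n) A 1 fun n hn => by
        have := 𝒳.coord_sum_smul_vec A (fun _ => 1) n
        simp only [one_smul] at this
        simp [this, hn]
      rwa [one_mul] at this)
  refine ⟨⟨max 1 (C₁ * C₂), le_max_left _ _, fun A B hAB => ?_⟩, hXl.trans hYl.symm,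
    hYl.trans hYu.symm, hYu.trans hXu.symm⟩
  calc q (∑ n ∈ A, 𝒴.vec n) ≤ C₁ * realUpperDemocracy q 𝒳.vec A.card := h₁ A
    _ ≤ C₁ * (C₂ * q (∑ n ∈ B, 𝒴.vec n)) := by
      gcongr
      exact (hX.mono hAB).trans (h₂ B)
    _ = C₁ * C₂ * q (∑ n ∈ B, 𝒴.vec n) := by ring
    _ ≤ _ := mul_le_mul_of_nonneg_right (le_max_right _ _) (q.nonneg _)
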